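/- \textbf{Setting.} In one segment of the symmetric Tardos scheme a bias $p\in[0,1]$ is drawn from a probability distribution $\mu$ (a bias distribution); each of $C$ colluders independently receives a bit $X_j\sim\mathrm{Bernoulli}(p)$; seeing the received bits but not $p$, the colluders output a (possibly randomised) bit $y$ that at least one of them received (marking assumption). Colluder $j$ gets the symbol-symmetric score $g(X_j,y,p)$, where $g(1,1,p)=-g(1,0,p)=\sqrt{(1-p)/p}$ and $g(0,0,p)=-g(0,1,p)=\sqrt{p/(1-p)}$. The expected coalition score of a strategy $\rho$ is $S_C(\mu,\rho)=\mathbb{E}\big[\sum_{j=1}^{C} g(X_j,y,p)\big]$. Call $\mu$ strategy independent for $C$ colluders if $S_C(\mu,\rho)$ does not depend on $\rho$, and call $\mu$ optimal against $C$ colluders if it maximises the expected coalition score among the bias distributions that are strategy independent for $C$ colluders. For $c\ge 1$ let $P_c(x)=\frac{1}{2^c c!}\left(\frac{d}{dx}\right)^c(x^2-1)^c$ be the Legendre polynomial, with roots $x_{1,c}<\dots<x_{c,c}$ in $(-1,1)$, and put $p_{k,c}=\frac{x_{k,c}+1}{2}$, $w_{k,c}=\frac{2}{(1-x_{k,c}^2)^{3/2}P_c'(x_{k,c})^2}$,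 $N_c=\sum_{k=1}^c w_{k,c}$, and $$F_{2c-1}(p)=F_{2c}(p)=\frac1{N_c}\sum_{k=1}^c w_{k,c}\,H(p-p_{k,c}),$$ where $H$ is the Heaviside step function with $H(0)=1$. Let $F_\infty(p)=\frac2\pi\arcsin\sqrt p$ for $0\le p\le1$ be the arcsine distribution function. \textbf{Theorem.} (1) For every $c\ge1$, $F_{2c}$ is the distribution function of the discrete distribution with mass $w_{k,c}/N_c$ at each $p_{k,c}$, and, both against $2c-1$ and against $2c$ colluders, this distribution is optimal and is the only optimal bias distribution. (2) For every $p\in(0,1)$, $F_{2c}(p)\to F_\infty(p)$ as $c\to\infty$. (3) The arcsine distribution $\mu_\infty$, with distribution function $F_\infty$, is asymptotically optimal, even among all bias distributions: for all sufficiently large $C$ one has $\inf_\rho S_C(\mu_\infty,\rho)>0$, and for every $\varepsilon>0$ there is a $C_0$ such that for all $C\ge C_0$ and every bias distribution $\nu$, strategy independent or not, $$\inf_\rho S_C(\nu,\rho)\le(1+\varepsilon)\,\inf_\rho S_C(\mu_\infty,\rho).$$ -/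

import Mathlib

open MeasureTheory ProbabilityTheory Filter Topology
open scoped Polynomial

noncomputable section

namespace Tardos

/-- The symbol-symmetric score `g(X, y, p)` of a user with bit `X`, when the pirate output is `y`
and the bias is `p`. -/
def score (X y : Bool) (p : ℝ) : ℝ :=
  match X, y with
  | true, true => √((1 - p) / p)
  | true, false => -√((1 - p) / p)
  | false, true => -√(p / (1 - p))
  | false, false => √(p / (1 - p))

/-- A (randomised) strategy of `C` colluders in one segment: `probOne x` is the probability of
the output `y = 1` when the colluders received the bits `x`. By the marking assumption, they can
only output a bit that at least one of them received. -/
structure PirateStrategy (C : ℕ) where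
  probOne : (Fin C → Bool) → ℝ
  probOne_mem : ∀ x, probOne x ∈ Set.Icc (0 : ℝ) 1
  probOne_ones : probOne (fun _ => true) = 1
  probOne_zeros : probOne (fun _ => false) = 0

/-- The probability that the colluders receive the bits `x`, which are independent
`Bernoulli(p)`. -/
def columnProb {C : ℕ} (p : ℝ) (x : Fin C → Bool) : ℝ :=
  ∏ j, if x j then p else 1 - p

/-- The expected total score of the coalition in one segment, given the bias `p`. -/
def coalitionScoreAt {C : ℕ} (ρ : PirateStrategy C) (p : ℝ) : ℝ :=
  ∑ x : Fin C → Bool, columnProb p x *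
    (ρ.probOne x * ∑ j, score (x j) true p + (1 - ρ.probOne x) * ∑ j, score (x j) false p)

/-- The expected total score of the coalition in one segment, when the bias is drawn from `μ`. -/
def coalitionScore {C : ℕ} (μ : Measure ℝ) (ρ : PirateStrategy C) : ℝ :=
  ∫ p, coalitionScoreAt ρ p ∂μ

/-- `μ` is a probability distribution on `[0, 1]`. A bias `0` or `1` is allowed; the bits for
which the score is then not defined occur with probability zero. -/
def IsBiasDistribution (μ : Measure ℝ) : Prop :=
  IsProbabilityMeasure μ ∧ μ (Set.Icc (0 : ℝ) 1)ᶜ = 0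

/-- The expected score of `C` colluders does not depend on the strategy that they follow. -/
def IsStrategyIndependent (C : ℕ) (μ : Measure ℝ) : Prop :=
  ∀ ρ ρ' : PirateStrategy C, coalitionScore μ ρ = coalitionScore μ ρ'

/-- `μ` is optimal against `C` colluders: it maximises the expected coalition score among the bias
distributions for which this score does not depend on the strategy of the colluders. -/
def IsOptimal (C : ℕ) (μ : Measure ℝ) : Prop :=
  IsBiasDistribution μ ∧ IsStrategyIndependent C μ ∧
    ∀ ν : Measure ℝ, IsBiasDistribution ν → IsStrategyIndependent C ν →
      ∀ ρ : PirateStrategy C, coalitionScore ν ρ ≤ coalitionScore μ ρ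

/-- The expected score per segment that `μ` guarantees against every strategy of `C` colluders. -/
def guaranteedScore (C : ℕ) (μ : Measure ℝ) : ℝ :=
  ⨅ ρ : PirateStrategy C, coalitionScore μ ρ

/-- `μ` is asymptotically optimal: it guarantees a positive score, and up to a factor `1 + o(1)`,
as the number `C` of colluders grows, no bias distribution `ν` whatsoever (which may depend on `C`,
and need not be strategy independent) guarantees a larger one. -/
def IsAsymptoticallyOptimal (μ : Measure ℝ) : Prop :=
  IsBiasDistribution μ ∧ (∀ᶠ C : ℕ in atTop, 0 < guaranteedScore C μ) ∧
    ∀ ε : ℝ, 0 < ε → ∀ᶠ C : ℕ in atTop, ∀ ν : Measure ℝ, IsBiasDistribution ν →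
      guaranteedScore C ν ≤ (1 + ε) * guaranteedScore C μ

/-- The Legendre polynomial `P_c`, by Rodrigues' formula. -/
def legendre (c : ℕ) : ℝ[X] :=
  Polynomial.C (1 / (2 ^ c * (c.factorial : ℝ))) *
    Polynomial.derivative^[c] ((Polynomial.X ^ 2 - 1) ^ c)

/-- The roots `x_{1,c}, …, x_{c,c}` of `P_c`. -/
def nodes (c : ℕ) : Finset ℝ := (legendre c).roots.toFinset

/-- The point `p_{k,c}` that belongs to the root `x = x_{k,c}`. -/
def point (x : ℝ) : ℝ := (x + 1) / 2

/-- The weight `w_{k,c}` that belongs to the root `x = x_{k,c}`. -/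
def weight (c : ℕ) (x : ℝ) : ℝ :=
  2 / ((1 - x ^ 2) ^ (3 / 2 : ℝ) * ((legendre c).derivative.eval x) ^ 2)

/-- The normalising constant `N_c`. -/
def normConst (c : ℕ) : ℝ := ∑ x ∈ nodes c, weight c x

/-- The Heaviside step function. -/
def heaviside (t : ℝ) : ℝ := if 0 ≤ t then 1 else 0

/-- The distribution function `F_{2c} = F_{2c-1}`. -/
def gaussLegendreCDF (c : ℕ) (p : ℝ) : ℝ :=
  1 / normConst c * ∑ x ∈ nodes c, weight c x * heaviside (p - point x)

/-- The discrete probability distribution with the mass `w_{k,c} / N_c` at each `p_{k,c}`. -/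
def gaussLegendreDist (c : ℕ) : Measure ℝ :=
  ∑ x ∈ nodes c, ENNReal.ofReal (weight c x / normConst c) • Measure.dirac (point x)

/-- The distribution function `F_∞` of the arcsine distribution. As `√p = 0` for `p ≤ 0` and
`Real.arcsin t = π / 2` for `1 ≤ t`, it is `0` on the left and `1` on the right of `[0, 1]`. -/
def arcsineCDF (p : ℝ) : ℝ := 2 / Real.pi * Real.arcsin √p

/-- The arcsine distribution function as a right-continuous monotone function. -/
def arcsineStieltjes : StieltjesFunction ℝ where
  toFun := arcsineCDF
  mono' := fun _ _ h => mul_le_mul_of_nonneg_left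
    (Real.monotone_arcsin (Real.sqrt_le_sqrt h)) (by positivity)
  right_continuous' := fun _ => Continuous.continuousWithinAt
    (continuous_const.mul (Real.continuous_arcsin.comp Real.continuous_sqrt))

/-- The arcsine distribution, that is, the measure with distribution function `F_∞`. -/
def arcsineDist : Measure ℝ := arcsineStieltjes.measure

end Tardos

end

open Tardos

noncomputable section

namespace Tardos

section

open Polynomial

/-! Let `f` be the probability of the output 1 as a function of the bias `p`. It is a polynomial of
degree at most `C`, with `f 0 = 0` and `f 1 = 1` by the marking assumption, and the coalition score
at `p` is `2 √(p (1 - p)) f' p` (`coalitionScoreAt_eq`). Unanimity strategies give all monomials `f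
= X ^ i` with `1 ≤ i ≤ C`. Hence `μ` is strategy independent exactly if `√(p (1 - p)) dμ` integrates
polynomials of degree less than `C` as `κ dp` does, for some constant `κ`; the score is then `2 κ`.
Gauss–Legendre quadrature provides such a measure, with `κ = 1 / N_c`.

To bound `κ`, put `x = 2 p - 1` and interpolate the kernel `1 / (1 - x² + t²)` to second order at
the Legendre nodes. The interpolant has degree at most `2 c - 2`, and the error is a nonnegative
multiple of `P_c(x)² / (1 - x² + t²)`. So `μ` integrates the kernel to at least the quadrature
value. As `∫ dt / (s + t²) = π / √s`, integration over `t` cancels the factor `√(p (1 - p))` and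
leaves `κ N_c ≤ μ (0, 1) ≤ 1`. Equality forces the error to vanish `μ`-almost everywhere, so `μ`
lives on the nodes, where its moments determine it. The degree `2 c - 2` already suffices, which is
why `2 c - 1` and `2 c` colluders share one optimum.

The arcsine distribution has `κ = 1 / π` for every `C`, so `N_c ≤ π`. Quadrature of bounded
functions below `1 / √(1 - x²)` bounds the node weights on either side of a point from below; the
two bounds add up to `π`, so both are sharp in the limit.

The arcsine score is always `2 / π`. Conversely, colluders who output 1 with probability `G (k /
C)`, for `k` received ones and `G` a smoothed arcsine distribution function, make `f` a Bernstein
polynomial of `G`. Then `f'` is nearly `G'`, and the score is nearly at most `2 / π` at every bias,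
so no `ν` does better asymptotically. -/

/-! ### Integrals of polynomials -/

theorem hasDerivAt_eval (p : ℝ[X]) (x : ℝ) :
    HasDerivAt (fun y => p.eval y) (p.derivative.eval x) x := p.hasDerivAt x

theorem intervalIntegrable_eval (p : ℝ[X]) (a b : ℝ) :
    IntervalIntegrable (fun x => p.eval x) (volume : Measure ℝ) a b :=
  p.continuous.intervalIntegrable a b

theorem integral_eval_derivative (p : ℝ[X]) (a b : ℝ) :
    ∫ x in a..b, p.derivative.eval x = p.eval b - p.eval a :=
  intervalIntegral.integral_eq_sub_of_hasDerivAt (fun x _ => hasDerivAt_eval p x)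
    (intervalIntegrable_eval _ _ _)

theorem integral_eval_mul_derivative (p q : ℝ[X]) (a b : ℝ) :
    ∫ x in a..b, (p.derivative * q).eval x =
      p.eval b * q.eval b - p.eval a * q.eval a - ∫ x in a..b, (p * q.derivative).eval x := by
  have h := integral_eval_derivative (p * q) a b
  simp only [derivative_mul, eval_add] at h
  rw [intervalIntegral.integral_add (intervalIntegrable_eval _ _ _)
    (intervalIntegrable_eval _ _ _)] at h
  simp only [eval_mul] at h ⊢
  linarith

/-- A nonzero polynomial that is nonnegative on an interval has positive integral over it. -/
theorem integral_eval_pos {p : ℝ[X]} {a b : ℝ} (hab : a < b) (hp : p ≠ 0)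
    (h : ∀ x ∈ Set.Ioo a b, 0 ≤ p.eval x) : 0 < ∫ x in a..b, p.eval x := by
  obtain ⟨y, hy, hy0⟩ : ∃ y ∈ Set.Ioo a b, p.eval y ≠ 0 := by
    by_contra! H
    exact hp (p.eq_zero_of_infinite_isRoot ((Set.Ioo_infinite hab).mono fun x hx => H x hx))
  have h' : ∀ x ∈ Set.Icc a b, 0 ≤ p.eval x := by
    rw [← closure_Ioo hab.ne]
    exact fun x hx => closure_minimal (t := {x | 0 ≤ p.eval x}) h
      (isClosed_le continuous_const p.continuous) hx
  exact intervalIntegral.integral_pos hab p.continuous.continuousOn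
    (fun x hx => h' x (Set.Ioc_subset_Icc_self hx))
    ⟨y, Set.Ioo_subset_Icc_self hy, lt_of_le_of_ne (h y hy) hy0.symm⟩

/-! ### Legendre polynomials and their roots -/

/-- The scaling factor in Rodrigues' formula. -/
def rodriguesFactor (c : ℕ) : ℝ := 1 / (2 ^ c * (c.factorial : ℝ))

theorem rodriguesFactor_pos (c : ℕ) : 0 < rodriguesFactor c := by
  unfold rodriguesFactor; positivity

theorem legendre_eq (c : ℕ) :
    legendre c = C (rodriguesFactor c) * derivative^[c] ((X ^ 2 - 1 : ℝ[X]) ^ c) := rfl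

theorem X_sq_sub_one_eq : (X ^ 2 - 1 : ℝ[X]) = (X - C 1) * (X - C (-1)) := by
  simp only [map_neg, map_one]; ring

theorem natDegree_X_sq_sub_one : (X ^ 2 - 1 : ℝ[X]).natDegree = 2 := by
  compute_degree!

theorem natDegree_legendre_le (c : ℕ) : (legendre c).natDegree ≤ c := by
  refine (natDegree_C_mul_le _ _).trans ((natDegree_iterate_derivative _ _).trans ?_)
  rw [natDegree_pow, natDegree_X_sq_sub_one]
  omega

theorem eval_one_legendre (c : ℕ) : (legendre c).eval 1 = 1 := by
  have h := aeval_iterate_derivative_self ((X ^ 2 - 1 : ℝ[X]) ^ c) c (1 : ℝ)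
    (p' := (X - C (-1)) ^ c) (by simp only [Algebra.algebraMap_self, Polynomial.map_id, X_sq_sub_one_eq, mul_pow])
  rw [coe_aeval_eq_eval] at h
  rw [legendre_eq, eval_mul, h, rodriguesFactor]
  simp only [eval_C, eval_pow, eval_sub, eval_X, nsmul_eq_mul]
  norm_num
  field_simp

theorem legendre_comp_neg (c : ℕ) : (legendre c).comp (-X) = (-1) ^ c * legendre c := by
  have h : ∀ (k : ℕ) (p : ℝ[X]), p.comp (-X) = p →
      (derivative^[k] p).comp (-X) = (-1) ^ k * derivative^[k] p := by
    intro k p hp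
    induction k with
    | zero => simpa using hp
    | succ k ih =>
      have h1 := congrArg derivative ih
      rw [derivative_comp] at h1
      have h2 : derivative ((-1) ^ k * derivative^[k] p : ℝ[X]) =
          (-1) ^ k * derivative (derivative^[k] p) := by
        rw [show ((-1) ^ k : ℝ[X]) = C ((-1) ^ k) by simp, derivative_C_mul]
      rw [h2] at h1
      rw [Function.iterate_succ_apply', pow_succ]
      simp only [derivative_neg, derivative_X] at h1
      linear_combination -h1
  rw [legendre_eq, mul_comp, h c _ (by simp), C_comp]
  ring

theorem eval_neg_legendre (c : ℕ) (x : ℝ) :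
    (legendre c).eval (-x) = (-1) ^ c * (legendre c).eval x := by
  have h := congrArg (eval x) (legendre_comp_neg c)
  simpa [eval_comp] using h

theorem eval_neg_legendre_sq (c : ℕ) (x : ℝ) :
    (legendre c).eval (-x) ^ 2 = (legendre c).eval x ^ 2 := by
  rw [eval_neg_legendre, mul_pow, ← pow_mul, mul_comm c, pow_mul]
  simp

theorem legendre_ne_zero (c : ℕ) : legendre c ≠ 0 := fun h => by
  have := eval_one_legendre c
  simp [h] at this

theorem eval_iterate_derivative_X_sq_sub_one {c k : ℕ} (hk : k < c) {a : ℝ} (ha : a ^ 2 = 1) :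
    (derivative^[k] ((X ^ 2 - 1 : ℝ[X]) ^ c)).eval a = 0 := by
  have h := pow_sub_dvd_iterate_derivative_of_pow_dvd (p := (X ^ 2 - 1 : ℝ[X]) ^ c) k dvd_rfl
  obtain ⟨q, hq⟩ := (dvd_pow_self (X ^ 2 - 1 : ℝ[X]) (Nat.sub_ne_zero_of_lt hk)).trans h
  rw [hq]
  simp [ha]

/-- The Legendre polynomial is orthogonal to every polynomial of smaller degree. -/
theorem integral_legendre_mul {c : ℕ} {q : ℝ[X]} (hq : q.degree < c) :
    ∫ x in (-1 : ℝ)..1, (legendre c * q).eval x = 0 := by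
  -- Each integration by parts moves one derivative to `q`. The boundary terms vanish because fewer
  -- than `c` derivatives of `(X² - 1) ^ c` leave a zero at `±1`.
  have key : ∀ k ≤ c, ∀ q : ℝ[X], derivative^[k] q = 0 →
      ∫ x in (-1 : ℝ)..1, (derivative^[k] ((X ^ 2 - 1 : ℝ[X]) ^ c) * q).eval x = 0 := by
    intro k
    induction k with
    | zero => intro _ q hq; simp only [Function.iterate_zero, id] at hq; simp [hq]
    | succ k ih =>
      intro hk q hq
      rw [Function.iterate_succ_apply', integral_eval_mul_derivative, ih (by omega) _ (by simpa using hq),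
        eval_iterate_derivative_X_sq_sub_one hk (by norm_num),
        eval_iterate_derivative_X_sq_sub_one hk (by norm_num)]
      simp
  have h0 : derivative^[c] q = 0 := by
    by_cases hq0 : q = 0
    · simp [hq0]
    · exact iterate_derivative_eq_zero ((natDegree_lt_iff_degree_lt hq0).2 hq)
  have := key c le_rfl q h0
  rw [legendre_eq]
  simp only [mul_assoc, eval_mul, eval_C] at this ⊢
  rw [intervalIntegral.integral_const_mul, this, mul_zero]

/-- By Rolle's theorem, with multiplicities, each derivative loses at most one real root, and `(X² -
1) ^ c` starts with `2 c` of them. -/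
theorem card_roots_legendre (c : ℕ) : c ≤ Multiset.card (legendre c).roots := by
  have key : ∀ k, 2 * c ≤ Multiset.card (derivative^[k] ((X ^ 2 - 1 : ℝ[X]) ^ c)).roots + k := by
    intro k
    induction k with
    | zero =>
      rw [Function.iterate_zero, id, roots_pow, X_sq_sub_one_eq,
        roots_mul (mul_ne_zero (X_sub_C_ne_zero _) (X_sub_C_ne_zero _)), roots_X_sub_C,
        roots_X_sub_C]
      simp; omega
    | succ k ih =>
      have := card_roots_le_derivative (derivative^[k] ((X ^ 2 - 1 : ℝ[X]) ^ c))
      rw [Function.iterate_succ_apply']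
      omega
  rw [legendre_eq, roots_C_mul _ (rodriguesFactor_pos c).ne']
  have := key c
  omega

theorem natDegree_legendre (c : ℕ) : (legendre c).natDegree = c :=
  le_antisymm (natDegree_legendre_le c) ((card_roots_legendre c).trans (card_roots' _))

theorem mem_nodes {c : ℕ} {x : ℝ} : x ∈ nodes c ↔ (legendre c).eval x = 0 := by
  simp [nodes, legendre_ne_zero, IsRoot]

theorem eq_mul_of_mem_nodes {c : ℕ} {x : ℝ} (hx : x ∈ nodes c) :
    ∃ q : ℝ[X], legendre c = (X - C x) * q ∧ q ≠ 0 ∧ q.degree < c ∧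
      (legendre c).derivative.eval x = q.eval x := by
  obtain ⟨q, hq⟩ := dvd_iff_isRoot.2 (mem_nodes.1 hx)
  have hq0 : q ≠ 0 := by rintro rfl; exact legendre_ne_zero c (by simpa using hq)
  refine ⟨q, hq, hq0, ?_, by simp [hq]⟩
  have h := natDegree_legendre c
  rw [hq, natDegree_mul (X_sub_C_ne_zero x) hq0, natDegree_X_sub_C] at h
  exact (natDegree_lt_iff_degree_lt hq0).1 (by omega)

/-- At a double root, `P_c = (X - x)² s`, so `P_c s` is a square with positive integral, against
orthogonality to `s`. -/
theorem derivative_legendre_ne_zero {c : ℕ} {x : ℝ} (hx : x ∈ nodes c) :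
    (legendre c).derivative.eval x ≠ 0 := by
  obtain ⟨q, hq, hq0, hqd, hd⟩ := eq_mul_of_mem_nodes hx
  rw [hd]
  intro h
  obtain ⟨s, hs⟩ := dvd_iff_isRoot.2 (show q.IsRoot x from h)
  have hs0 : s ≠ 0 := by rintro rfl; exact hq0 (by simpa using hs)
  have hsd : s.degree < c := by
    refine lt_of_le_of_lt ?_ hqd
    rw [hs]
    rw [mul_comm]
    exact degree_le_mul_left s (X_sub_C_ne_zero x)
  have h1 := integral_legendre_mul hsd
  have h2 : 0 < ∫ y in (-1 : ℝ)..1, (legendre c * s).eval y := by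
    refine integral_eval_pos (by norm_num) (mul_ne_zero (legendre_ne_zero c) hs0) fun y _ => ?_
    have : (legendre c * s).eval y = ((y - x) * s.eval y) ^ 2 := by
      rw [hq, hs]; simp; ring
    rw [this]; positivity
  linarith

/-- If `P_c = (X - x) q`, then `P_c q = (X - x) q²` would have constant sign on `(-1, 1)` for a root
`x` outside, against orthogonality to `q`. -/
theorem nodes_subset {c : ℕ} {x : ℝ} (hx : x ∈ nodes c) : x ∈ Set.Ioo (-1 : ℝ) 1 := by
  obtain ⟨q, hq, hq0, hqd, hd⟩ := eq_mul_of_mem_nodes hx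
  have h1 := integral_legendre_mul hqd
  have hne := mul_ne_zero (legendre_ne_zero c) hq0
  have h2 : ∀ y, (legendre c * q).eval y = (y - x) * (q.eval y) ^ 2 := by
    intro y; rw [hq]; simp; ring
  by_contra hx'
  rw [Set.mem_Ioo, not_and_or, not_lt, not_lt] at hx'
  rcases hx' with hx' | hx'
  · have := integral_eval_pos (by norm_num : (-1 : ℝ) < 1) hne fun y hy => by
      rw [h2]; exact mul_nonneg (by linarith [hy.1]) (sq_nonneg _)
    linarith
  · have := integral_eval_pos (by norm_num : (-1 : ℝ) < 1) (neg_ne_zero.2 hne) fun y hy => by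
      rw [eval_neg, h2, ← neg_mul]; exact mul_nonneg (by linarith [hy.2]) (sq_nonneg _)
    simp only [eval_neg, intervalIntegral.integral_neg] at this
    linarith

theorem card_nodes (c : ℕ) : (nodes c).card = c := by
  have hnd : (legendre c).roots.Nodup := by
    rw [Multiset.nodup_iff_count_le_one]
    intro x
    rw [count_roots]
    by_contra! h
    have hx : x ∈ nodes c := by
      rw [mem_nodes]
      exact (rootMultiplicity_pos (legendre_ne_zero c)).1 (by omega)
    exact derivative_legendre_ne_zero hx
      (((one_lt_rootMultiplicity_iff_isRoot (legendre_ne_zero c)).1 h).2)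
  rw [nodes, Multiset.toFinset_card_of_nodup hnd]
  exact le_antisymm ((card_roots' _).trans (natDegree_legendre_le c)) (card_roots_legendre c)

/-! ### Gauss–Legendre quadrature -/

/-- The weights of the Gauss–Legendre quadrature rule on `[-1, 1]`. -/
def gaussWeight (c : ℕ) (x : ℝ) : ℝ :=
  2 / ((1 - x ^ 2) * (legendre c).derivative.eval x ^ 2)

theorem one_sub_sq_pos {x : ℝ} (hx : x ∈ Set.Ioo (-1 : ℝ) 1) : 0 < 1 - x ^ 2 := by
  nlinarith [hx.1, hx.2]

theorem gaussWeight_pos {c : ℕ} {x : ℝ} (hx : x ∈ nodes c) : 0 < gaussWeight c x := by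
  have h1 := one_sub_sq_pos (nodes_subset hx)
  have h2 := derivative_legendre_ne_zero hx
  unfold gaussWeight
  positivity

/-- A quadrature rule at the roots of the Legendre polynomial is exact up to degree `2 c - 1`. -/
theorem exists_quadrature (c : ℕ) : ∃ a : ℝ → ℝ, ∀ r : ℝ[X], r.degree < (2 * c : ℕ) →
    ∫ x in (-1 : ℝ)..1, r.eval x = ∑ x ∈ nodes c, a x * r.eval x := by
  -- The weights are the integrals of the Lagrange basis. Modulo `P_c` the rule is exact by
  -- interpolation; the quotient has degree below `c`, so its product with `P_c` integrates to zero
  -- and vanishes at the nodes.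
  refine ⟨fun x => ∫ y in (-1 : ℝ)..1, (Lagrange.basis (nodes c) id x).eval y, fun r hr => ?_⟩
  have hinj : Set.InjOn (id : ℝ → ℝ) (nodes c) := Function.injective_id.injOn
  have hmod : (r % legendre c).degree < (nodes c).card := by
    rw [card_nodes]
    refine (EuclideanDomain.mod_lt r (legendre_ne_zero c)).trans_eq ?_
    rw [degree_eq_natDegree (legendre_ne_zero c), natDegree_legendre]
  have hdiv : (r / legendre c).degree < c := by
    by_cases h0 : r / legendre c = 0
    · rw [h0, degree_zero]; exact WithBot.bot_lt_coe c
    · have hr0 : r ≠ 0 := by rintro rfl; simp at h0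
      refine (natDegree_lt_iff_degree_lt h0).1 ?_
      have h1 := (natDegree_lt_iff_degree_lt hr0).2 hr
      have h2 := degree_add_div (legendre_ne_zero c)
        (not_lt.1 fun h => h0 ((Polynomial.div_eq_zero_iff (legendre_ne_zero c)).2 h))
      rw [degree_eq_natDegree (legendre_ne_zero c), degree_eq_natDegree h0,
        degree_eq_natDegree hr0, natDegree_legendre] at h2
      have h3 : c + (r / legendre c).natDegree = r.natDegree := by exact_mod_cast h2
      omega
  have hval : ∀ x ∈ nodes c, (r % legendre c).eval x = r.eval x := by
    intro x hx
    conv_rhs => rw [← EuclideanDomain.div_add_mod r (legendre c)]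
    simp [mem_nodes.1 hx]
  have hL : r % legendre c =
      ∑ x ∈ nodes c, C (r.eval x) * Lagrange.basis (nodes c) id x := by
    rw [Lagrange.eq_interpolate_of_eval_eq (fun x => r.eval x) hinj hmod hval,
      Lagrange.interpolate_apply]
  conv_lhs => rw [← EuclideanDomain.div_add_mod r (legendre c)]
  simp only [eval_add]
  rw [intervalIntegral.integral_add (intervalIntegrable_eval _ _ _)
    (intervalIntegrable_eval _ _ _), integral_legendre_mul hdiv, hL, zero_add]
  simp only [eval_finsetSum, eval_mul, eval_C]
  rw [intervalIntegral.integral_finsetSum]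
  · refine Finset.sum_congr rfl fun x _ => ?_
    rw [intervalIntegral.integral_const_mul, mul_comm]
  · intro x _
    exact (intervalIntegrable_eval _ _ _).const_mul _

/-- **Gauss–Legendre quadrature** is exact up to degree `2 c - 1`. -/
theorem gauss_quadrature {c : ℕ} {r : ℝ[X]} (hr : r.degree < (2 * c : ℕ)) :
    ∫ x in (-1 : ℝ)..1, r.eval x = ∑ x ∈ nodes c, gaussWeight c x * r.eval x := by
  obtain ⟨a, ha⟩ := exists_quadrature c
  rw [ha r hr]
  refine Finset.sum_congr rfl fun x hx => ?_
  obtain ⟨q, hq, hq0, hqd, hd⟩ := eq_mul_of_mem_nodes hx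
  have hx' := nodes_subset hx
  -- The weight is found by testing the rule on `P_c' q`, where `P_c = (X - x) q`. At the nodes only
  -- the term `a x * P_c'(x)²` survives, while integration by parts leaves the boundary terms `1 /
  -- (1 - x) + 1 / (1 + x) = 2 / (1 - x²)`.
  have hdeg : ((legendre c).derivative * q).degree < (2 * c : ℕ) := by
    have hqn := (natDegree_lt_iff_degree_lt hq0).2 hqd
    have h1 : ((legendre c).derivative * q).natDegree < 2 * c := by
      refine natDegree_mul_le.trans_lt ?_
      have := natDegree_derivative_le (legendre c)
      rw [natDegree_legendre] at this
      omega
    exact degree_le_natDegree.trans_lt (by exact_mod_cast h1)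
  have h1 := ha _ hdeg
  have hder : q.derivative.degree < c := (degree_derivative_le).trans_lt hqd
  rw [integral_eval_mul_derivative, integral_legendre_mul hder, Finset.sum_eq_single_of_mem x hx] at h1
  · have e1 : (1 - x) * q.eval 1 = 1 := by
      have h := eval_one_legendre c
      rw [hq] at h
      simpa using h
    have e2 : (legendre c).eval (-1) ^ 2 = 1 := by
      rw [eval_neg_legendre_sq, eval_one_legendre, one_pow]
    have e3 : (-1 - x) * q.eval (-1) = (legendre c).eval (-1) := by
      rw [hq]; simp
    rw [eval_mul, ← hd, eval_one_legendre] at h1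
    have p1 : 1 - x ≠ 0 := by linarith [hx'.2]
    have p2 : 1 + x ≠ 0 := by linarith [hx'.1]
    have e4 : q.eval 1 = 1 / (1 - x) := by field_simp; linarith
    have e5 : (legendre c).eval (-1) * q.eval (-1) = -1 / (1 + x) := by
      rw [← e3] at e2 ⊢
      field_simp
      linear_combination -e2
    rw [e4, e5] at h1
    have h3 := derivative_legendre_ne_zero hx
    have p3 := (one_sub_sq_pos hx').ne'
    have : a x = gaussWeight c x := by
      unfold gaussWeight
      rw [eq_div_iff (by positivity)]
      field_simp at h1
      linear_combination -h1
    rw [this]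
  · intro y hy hyx
    have : q.eval y = 0 := by
      have h := mem_nodes.1 hy
      rw [hq, eval_mul] at h
      exact (mul_eq_zero.1 h).resolve_left (by simpa using sub_ne_zero.2 hyx)
    simp [this]

/-! ### The coalition score as a derivative in the bias -/

/-- The polynomial in the bias whose value is the probability of the column `x`. -/
def columnPoly {C : ℕ} (x : Fin C → Bool) : ℝ[X] := ∏ j, if x j then X else 1 - X

/-- The polynomial in the bias whose value is the probability of the output `1`. -/
def outputPoly {C : ℕ} (ρ : PirateStrategy C) : ℝ[X] :=
  ∑ x, Polynomial.C (ρ.probOne x) * columnPoly x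

theorem eval_columnPoly {C : ℕ} (x : Fin C → Bool) (p : ℝ) :
    (columnPoly x).eval p = columnProb p x := by
  rw [columnPoly, columnProb, eval_prod]
  refine Finset.prod_congr rfl fun j _ => ?_
  split_ifs <;> simp

/-- This is the logarithmic derivative of the product, cleared of denominators. -/
theorem derivative_columnPoly_mul {C : ℕ} (x : Fin C → Bool) :
    derivative (columnPoly x) * (X * (1 - X)) =
      columnPoly x * ∑ j, if x j then 1 - X else -X := by
  rw [columnPoly, derivative_prod_finset, Finset.sum_mul, Finset.mul_sum]
  refine Finset.sum_congr rfl fun j hj => ?_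
  rw [← Finset.mul_prod_erase _ _ hj]
  split_ifs
  · simp; ring
  · simp; ring

theorem sum_prod_apply {C : ℕ} (f : Fin C → Bool → ℝ[X]) :
    ∑ x : Fin C → Bool, (∏ j, f j (x j)) = ∏ j, (f j true + f j false) := by
  have := Finset.prod_univ_sum (fun _ : Fin C => (Finset.univ : Finset Bool)) f
  simp only [Fintype.piFinset_univ, Fintype.sum_bool] at this
  exact this.symm

theorem sum_columnPoly (C : ℕ) : ∑ x : Fin C → Bool, columnPoly x = 1 := by
  have := sum_prod_apply (C := C) fun _ b => if b then X else 1 - X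
  simpa [columnPoly] using this

theorem score_false (X : Bool) (p : ℝ) : score X false p = -score X true p := by
  cases X <;> simp [score]

theorem sqrt_mul_score {p : ℝ} (hp : p ∈ Set.Ioo (0 : ℝ) 1) (X : Bool) :
    √(p * (1 - p)) * score X true p = if X then 1 - p else -p := by
  have h0 := hp.1
  have h1 : 0 < 1 - p := by linarith [hp.2]
  cases X
  · simp only [score, mul_neg, Bool.false_eq_true, if_false, neg_inj]
    rw [← Real.sqrt_mul (by positivity), show p * (1 - p) * (p / (1 - p)) = p ^ 2 by field_simp,
      Real.sqrt_sq h0.le]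
  · simp only [score, if_true]
    rw [← Real.sqrt_mul (by positivity),
      show p * (1 - p) * ((1 - p) / p) = (1 - p) ^ 2 by field_simp, Real.sqrt_sq h1.le]

/-- For the output 1 the score of a bit is `(X - p) / √(p (1 - p))`, which is `√(p (1 - p))` times
the logarithmic derivative of the probability of that bit. -/
theorem columnProb_mul_score {C : ℕ} {p : ℝ} (hp : p ∈ Set.Ioo (0 : ℝ) 1) (x : Fin C → Bool) :
    columnProb p x * ∑ j, score (x j) true p =
      √(p * (1 - p)) * (derivative (columnPoly x)).eval p := by
  have h1 : 0 < 1 - p := by linarith [hp.2]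
  have hpos : 0 < p * (1 - p) := mul_pos hp.1 h1
  have hs := Real.mul_self_sqrt hpos.le
  have hs0 := Real.sqrt_pos.2 hpos
  have h := congrArg (eval p) (derivative_columnPoly_mul x)
  have h2 : eval p (∑ j, if x j then 1 - X else -X) =
      √(p * (1 - p)) * ∑ j, score (x j) true p := by
    rw [Finset.mul_sum, eval_finsetSum]
    refine Finset.sum_congr rfl fun j _ => ?_
    rw [sqrt_mul_score hp]
    split_ifs <;> simp
  rw [eval_mul, eval_mul (p := columnPoly x), h2, eval_columnPoly] at h
  simp only [eval_mul, eval_X, eval_sub, eval_one] at h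
  refine mul_left_cancel₀ hs0.ne' ?_
  linear_combination -h + (derivative (columnPoly x)).eval p * -hs

theorem score_zero (X y : Bool) : score X y 0 = 0 := by cases X <;> cases y <;> simp [score]

theorem score_one (X y : Bool) : score X y 1 = 0 := by cases X <;> cases y <;> simp [score]

/-- The coalition score in terms of the probability of the output `1` as a function of the bias. -/
theorem coalitionScoreAt_eq {C : ℕ} (ρ : PirateStrategy C) {p : ℝ} (hp : p ∈ Set.Icc (0 : ℝ) 1) :
    coalitionScoreAt ρ p = 2 * (√(p * (1 - p)) * (derivative (outputPoly ρ)).eval p) := by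
  -- At both endpoints the right side has the factor `√0`, and every score is `0` because division
  -- by zero gives `0`.
  rcases hp.1.eq_or_lt with rfl | h0
  · simp [coalitionScoreAt, score_zero]
  rcases hp.2.eq_or_lt with rfl | h1
  · simp [coalitionScoreAt, score_one]
  have hp' : p ∈ Set.Ioo (0 : ℝ) 1 := ⟨h0, h1⟩
  -- The column probabilities sum to 1, so their derivatives sum to 0; this removes the `-1` from
  -- the coefficients `2 * ρ.probOne x - 1`.
  have hsum := congrArg (fun q => eval p (derivative q)) (sum_columnPoly C)
  simp only [derivative_sum, eval_finsetSum, derivative_one, eval_zero] at hsum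
  have hterm : ∀ x : Fin C → Bool, columnProb p x *
      (ρ.probOne x * ∑ j, score (x j) true p + (1 - ρ.probOne x) * ∑ j, score (x j) false p) =
      √(p * (1 - p)) * (2 * (ρ.probOne x * (derivative (columnPoly x)).eval p) -
        (derivative (columnPoly x)).eval p) := by
    intro x
    simp only [score_false, Finset.sum_neg_distrib]
    linear_combination (2 * ρ.probOne x - 1) * columnProb_mul_score hp' x
  rw [coalitionScoreAt, Finset.sum_congr rfl fun x _ => hterm x, ← Finset.mul_sum,
    Finset.sum_sub_distrib, hsum, ← Finset.mul_sum, outputPoly]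
  simp only [derivative_sum, eval_finsetSum, derivative_C_mul, eval_mul, eval_C]
  ring

theorem eval_zero_outputPoly {C : ℕ} (ρ : PirateStrategy C) : (outputPoly ρ).eval 0 = 0 := by
  simp only [outputPoly, eval_finsetSum, eval_mul, eval_C, eval_columnPoly]
  refine Finset.sum_eq_zero fun x _ => ?_
  by_cases hx : ∃ j, x j = true
  · obtain ⟨j, hj⟩ := hx
    rw [columnProb, Finset.prod_eq_zero (Finset.mem_univ j) (by simp [hj]), mul_zero]
  · have : x = fun _ => false := by funext j; simpa using fun h => hx ⟨j, h⟩
    rw [this, ρ.probOne_zeros, zero_mul]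

theorem eval_one_outputPoly {C : ℕ} (ρ : PirateStrategy C) : (outputPoly ρ).eval 1 = 1 := by
  simp only [outputPoly, eval_finsetSum, eval_mul, eval_C, eval_columnPoly]
  rw [Finset.sum_eq_single_of_mem (fun _ => true) (Finset.mem_univ _)]
  · simp [columnProb, ρ.probOne_ones]
  · intro x _ hx
    obtain ⟨j, hj⟩ := Function.ne_iff.1 hx
    rw [columnProb, Finset.prod_eq_zero (Finset.mem_univ j) (by simp [hj]), mul_zero]

theorem natDegree_outputPoly_le {C : ℕ} (ρ : PirateStrategy C) : (outputPoly ρ).natDegree ≤ C := by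
  refine natDegree_sum_le_of_forall_le _ _ fun x _ => ?_
  refine (natDegree_C_mul_le _ _).trans ((natDegree_prod_le _ _).trans ?_)
  refine (Finset.sum_le_card_nsmul _ _ 1 fun j _ => ?_).trans (by simp)
  split_ifs
  · exact natDegree_X_le
  · compute_degree

/-! ### Strategy independence as a moment condition -/

/-- The integral of `√(p (1 - p)) r(p)` against the distribution `μ` of the bias. -/
def biasIntegral (μ : Measure ℝ) (r : ℝ[X]) : ℝ := ∫ p, √(p * (1 - p)) * r.eval p ∂μ

namespace IsBiasDistribution

variable {μ : Measure ℝ}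

theorem ae_mem (hμ : IsBiasDistribution μ) : ∀ᵐ p ∂μ, p ∈ Set.Icc (0 : ℝ) 1 := hμ.2

theorem integrable_of_continuousOn (hμ : IsBiasDistribution μ) {f : ℝ → ℝ}
    (hf : ContinuousOn f (Set.Icc 0 1)) : Integrable f μ := by
  have := hμ.1
  rw [← Measure.restrict_eq_self_of_ae_mem hμ.ae_mem]
  exact hf.integrableOn_compact isCompact_Icc

theorem integrable_sqrt_mul (hμ : IsBiasDistribution μ) (r : ℝ[X]) :
    Integrable (fun p => √(p * (1 - p)) * r.eval p) μ :=
  hμ.integrable_of_continuousOn (by fun_prop)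

theorem coalitionScore_eq (hμ : IsBiasDistribution μ) {C : ℕ} (ρ : PirateStrategy C) :
    coalitionScore μ ρ = 2 * biasIntegral μ (derivative (outputPoly ρ)) := by
  rw [coalitionScore, biasIntegral, ← integral_const_mul]
  refine integral_congr_ae ?_
  filter_upwards [hμ.ae_mem] with p hp using coalitionScoreAt_eq ρ hp

theorem biasIntegral_sum (hμ : IsBiasDistribution μ) {ι : Type*} (s : Finset ι) (a : ι → ℝ)
    (r : ι → ℝ[X]) :
    biasIntegral μ (∑ i ∈ s, Polynomial.C (a i) * r i) = ∑ i ∈ s, a i * biasIntegral μ (r i) := by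
  simp only [biasIntegral, ← integral_const_mul]
  rw [← integral_finsetSum _ fun i _ => (hμ.integrable_sqrt_mul (r i)).const_mul (a i)]
  refine integral_congr_ae (.of_forall fun p => ?_)
  simp only [eval_finsetSum, eval_mul, eval_C, Finset.mul_sum]
  exact Finset.sum_congr rfl fun i _ => by ring

end IsBiasDistribution

/-- Against `μ`, the function `√(p (1 - p))` integrates polynomials of degree less than `C` as `κ`
times the Lebesgue measure on `[0, 1]` does. -/
def HasMoments (C : ℕ) (μ : Measure ℝ) (κ : ℝ) : Prop :=
  ∀ r : ℝ[X], r.degree < C → biasIntegral μ r = κ * ∫ p in (0 : ℝ)..1, r.eval p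

/-- The derivative of the output polynomial has degree below `C`, and its integral over `[0, 1]` is
1 by the marking assumption. -/
theorem HasMoments.coalitionScore_eq {C : ℕ} {μ : Measure ℝ} {κ : ℝ} (h : HasMoments C μ κ)
    (hμ : IsBiasDistribution μ) (ρ : PirateStrategy C) : coalitionScore μ ρ = 2 * κ := by
  have hd : (derivative (outputPoly ρ)).degree < C := by
    have h0 : outputPoly ρ ≠ 0 := fun h => by
      have := eval_one_outputPoly ρ
      simp [h] at this
    refine (degree_derivative_lt h0).trans_le (degree_le_natDegree.trans ?_)
    exact_mod_cast natDegree_outputPoly_le ρ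
  rw [hμ.coalitionScore_eq, h _ hd, integral_eval_derivative, eval_one_outputPoly,
    eval_zero_outputPoly]
  ring

/-- The strategy that outputs `1` if and only if all colluders in `T` received `1`. -/
def unanimityStrategy {C : ℕ} (T : Finset (Fin C)) (hT : T.Nonempty) : PirateStrategy C where
  probOne x := ∏ j, if j ∈ T then (if x j then 1 else 0) else 1
  probOne_mem x := ⟨Finset.prod_nonneg fun j _ => by split_ifs <;> simp,
    Finset.prod_le_one (fun j _ => by split_ifs <;> simp) fun j _ => by split_ifs <;> simp⟩
  probOne_ones := by simp
  probOne_zeros := by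
    obtain ⟨j, hj⟩ := hT
    exact Finset.prod_eq_zero (Finset.mem_univ j) (by simp [hj])

theorem outputPoly_unanimityStrategy {C : ℕ} (T : Finset (Fin C)) (hT : T.Nonempty) :
    outputPoly (unanimityStrategy T hT) = X ^ T.card := by
  simp only [outputPoly, unanimityStrategy, columnPoly, map_prod, ← Finset.prod_mul_distrib]
  rw [sum_prod_apply fun j b =>
    Polynomial.C (if j ∈ T then (if b then 1 else 0) else 1) * if b then X else 1 - X]
  rw [← Finset.prod_const, ← Finset.prod_subset (Finset.subset_univ T)]
  · exact Finset.prod_congr rfl fun j hj => by simp [hj]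
  · intro j _ hj
    simp [hj]

/-- Unanimity among `i + 1` colluders has the output polynomial `X ^ (i + 1)`, with derivative `(i +
1) X ^ i`, so equal scores fix all moments below `C`. -/
theorem IsStrategyIndependent.hasMoments {C : ℕ} {μ : Measure ℝ} (hμ : IsBiasDistribution μ)
    (h : IsStrategyIndependent C μ) (ρ : PirateStrategy C) :
    HasMoments C μ (coalitionScore μ ρ / 2) := by
  have key : ∀ i < C, biasIntegral μ (X ^ i) = coalitionScore μ ρ / 2 / (i + 1) := by
    intro i hi
    obtain ⟨T, -, hT⟩ := Finset.exists_subset_card_eq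
      (show i + 1 ≤ (Finset.univ : Finset (Fin C)).card by simpa using hi)
    have hne : T.Nonempty := Finset.card_pos.1 (by omega)
    have h1 := h (unanimityStrategy T hne) ρ
    rw [hμ.coalitionScore_eq, outputPoly_unanimityStrategy, hT] at h1
    have h2 : derivative (X ^ (i + 1) : ℝ[X]) =
        ∑ _j ∈ ({0} : Finset ℕ), Polynomial.C ((i : ℝ) + 1) * X ^ i := by
      simp
    rw [h2, hμ.biasIntegral_sum, Finset.sum_singleton] at h1
    have h3 : (i : ℝ) + 1 ≠ 0 := by positivity
    rw [← h1]
    field_simp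
  intro r hr
  have hr' : r = ∑ i ∈ Finset.range C, Polynomial.C (r.coeff i) * X ^ i := by
    rcases eq_or_ne r 0 with rfl | h0
    · simp
    · exact r.as_sum_range_C_mul_X_pow' ((natDegree_lt_iff_degree_lt h0).2 hr)
  rw [hr', hμ.biasIntegral_sum]
  simp only [eval_finsetSum, eval_mul, eval_C, eval_pow, eval_X]
  rw [intervalIntegral.integral_finsetSum]
  · rw [Finset.mul_sum]
    refine Finset.sum_congr rfl fun i hi => ?_
    rw [intervalIntegral.integral_const_mul, integral_pow, key i (Finset.mem_range.1 hi)]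
    simp
    ring
  · intro i _
    exact Continuous.intervalIntegrable (by fun_prop) _ _

/-! ### The Gauss–Legendre bias distribution -/

theorem weight_eq {c : ℕ} {x : ℝ} (hx : x ∈ nodes c) :
    weight c x = gaussWeight c x / √(1 - x ^ 2) := by
  have h := one_sub_sq_pos (nodes_subset hx)
  rw [weight, gaussWeight, div_div, show (3 / 2 : ℝ) = 1 + 1 / 2 by norm_num,
    Real.rpow_add h, Real.rpow_one, ← Real.sqrt_eq_rpow]
  ring

theorem weight_pos {c : ℕ} {x : ℝ} (hx : x ∈ nodes c) : 0 < weight c x := by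
  rw [weight_eq hx]
  exact div_pos (gaussWeight_pos hx) (Real.sqrt_pos.2 (one_sub_sq_pos (nodes_subset hx)))

theorem nodes_nonempty {c : ℕ} (hc : 1 ≤ c) : (nodes c).Nonempty :=
  Finset.card_pos.1 (by rw [card_nodes]; omega)

theorem normConst_pos {c : ℕ} (hc : 1 ≤ c) : 0 < normConst c :=
  Finset.sum_pos (fun _ => weight_pos) (nodes_nonempty hc)

theorem point_mem {x : ℝ} (hx : x ∈ Set.Ioo (-1 : ℝ) 1) : point x ∈ Set.Ioo (0 : ℝ) 1 := by
  unfold point; constructor <;> linarith [hx.1, hx.2]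

theorem sqrt_point (x : ℝ) : √(point x * (1 - point x)) = √(1 - x ^ 2) / 2 := by
  rw [show point x * (1 - point x) = (1 - x ^ 2) / 2 ^ 2 by unfold point; ring,
    Real.sqrt_div' _ (by positivity), Real.sqrt_sq (by norm_num)]

theorem weight_div_nonneg {c : ℕ} {x : ℝ} (hx : x ∈ nodes c) :
    0 ≤ weight c x / normConst c :=
  div_nonneg (weight_pos hx).le (Finset.sum_nonneg fun _ h => (weight_pos h).le)

theorem gaussLegendreDist_apply (c : ℕ) {s : Set ℝ} (hs : MeasurableSet s) :
    (gaussLegendreDist c) s =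
      ENNReal.ofReal (∑ x ∈ nodes c, weight c x / normConst c * s.indicator 1 (point x)) := by
  rw [ENNReal.ofReal_sum_of_nonneg fun x hx => mul_nonneg (weight_div_nonneg hx)
    (Set.indicator_nonneg (by simp) _), gaussLegendreDist, Measure.finsetSum_apply]
  refine Finset.sum_congr rfl fun x hx => ?_
  rw [Measure.smul_apply, Measure.dirac_apply' _ hs, smul_eq_mul,
    ENNReal.ofReal_mul (weight_div_nonneg hx)]
  by_cases h : point x ∈ s <;> simp [h]

theorem isBiasDistribution_gaussLegendreDist {c : ℕ} (hc : 1 ≤ c) :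
    IsBiasDistribution (gaussLegendreDist c) := by
  constructor
  · constructor
    rw [gaussLegendreDist_apply c .univ]
    simp only [Set.indicator_univ, Pi.one_apply, mul_one]
    rw [← Finset.sum_div, ← normConst, div_self (normConst_pos hc).ne', ENNReal.ofReal_one]
  · rw [gaussLegendreDist_apply c measurableSet_Icc.compl, ENNReal.ofReal_eq_zero]
    refine (Finset.sum_eq_zero fun x hx => ?_).le
    rw [Set.indicator_of_notMem, mul_zero]
    simpa using Set.Ioo_subset_Icc_self (point_mem (nodes_subset hx))

theorem cdf_gaussLegendreDist {c : ℕ} (hc : 1 ≤ c) (p : ℝ) :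
    cdf (gaussLegendreDist c) p = gaussLegendreCDF c p := by
  have := (isBiasDistribution_gaussLegendreDist hc).1
  rw [cdf_eq_real, Measure.real, gaussLegendreDist_apply c measurableSet_Iic, ENNReal.toReal_ofReal
    (Finset.sum_nonneg fun x hx => mul_nonneg (weight_div_nonneg hx)
      (Set.indicator_nonneg (by simp) _)), gaussLegendreCDF, Finset.mul_sum]
  refine Finset.sum_congr rfl fun x _ => ?_
  simp only [heaviside, Set.indicator, Set.mem_Iic, sub_nonneg, Pi.one_apply]
  ring

theorem integral_gaussLegendreDist (c : ℕ) (f : ℝ → ℝ) :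
    ∫ p, f p ∂gaussLegendreDist c = ∑ x ∈ nodes c, weight c x / normConst c * f (point x) := by
  rw [gaussLegendreDist, integral_finsetSum_measure fun x _ =>
    (integrable_dirac (by finiteness)).smul_measure ENNReal.ofReal_ne_top]
  refine Finset.sum_congr rfl fun x hx => ?_
  rw [integral_smul_measure, integral_dirac, ENNReal.toReal_ofReal (weight_div_nonneg hx),
    smul_eq_mul]

theorem degree_comp_lt {r : ℝ[X]} {n : ℕ} (hr : r.degree < n) {q : ℝ[X]} (hq : q.natDegree ≤ 1) :
    (r.comp q).degree < n := by
  rcases eq_or_ne r 0 with rfl | h0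
  · simp
  refine degree_le_natDegree.trans_lt ?_
  have h1 := (natDegree_lt_iff_degree_lt h0).2 hr
  have h2 := natDegree_comp_le (p := r) (q := q)
  have h3 : r.natDegree * q.natDegree ≤ r.natDegree * 1 := Nat.mul_le_mul_left _ hq
  exact_mod_cast (by omega : (r.comp q).natDegree < n)

theorem integral_comp_point (f : ℝ → ℝ) :
    ∫ x in (-1 : ℝ)..1, f (point x) = 2 * ∫ p in (0 : ℝ)..1, f p := by
  have h := intervalIntegral.integral_comp_mul_add (a := -1) (b := 1) f
    (show (1 / 2 : ℝ) ≠ 0 by norm_num) (1 / 2)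
  rw [show (1 / 2 : ℝ) * -1 + 1 / 2 = 0 by norm_num, show (1 / 2 : ℝ) * 1 + 1 / 2 = 1 by norm_num,
    show (1 / 2 : ℝ)⁻¹ = 2 by norm_num, smul_eq_mul] at h
  rw [← h]
  refine intervalIntegral.integral_congr fun x _ => ?_
  simp only [point]
  ring_nf

/-- The factor `√(1 - x²)` turns `weight` back into the Gauss weight, so the claim is exactness of
the quadrature in degrees below `2 c`. The `1 / 2` from `sqrt_point` matches the change of interval.
-/
theorem hasMoments_gaussLegendreDist {c C : ℕ} (hC : C ≤ 2 * c) :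
    HasMoments C (gaussLegendreDist c) (1 / normConst c) := by
  intro r hr
  have hq := gauss_quadrature (c := c) (r := r.comp (Polynomial.C (1 / 2) * X + Polynomial.C (1 / 2)))
    (degree_comp_lt (hr.trans_le (by exact_mod_cast hC)) (by compute_degree))
  have hp : ∀ x : ℝ, (r.comp (Polynomial.C (1 / 2) * X + Polynomial.C (1 / 2))).eval x =
      r.eval (point x) := fun x => by
    rw [eval_comp]; simp only [eval_add, eval_mul, eval_C, eval_X, point]; ring_nf
  simp only [hp] at hq
  rw [integral_comp_point fun p => r.eval p] at hq
  rw [biasIntegral, integral_gaussLegendreDist,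
    show ∫ p in (0 : ℝ)..1, r.eval p = 1 / 2 * ∑ x ∈ nodes c, gaussWeight c x * r.eval (point x) by
      rw [← hq]; ring, Finset.mul_sum, Finset.mul_sum]
  refine Finset.sum_congr rfl fun x hx => ?_
  have hs := Real.sqrt_pos.2 (one_sub_sq_pos (nodes_subset hx))
  rw [sqrt_point, weight_eq hx]
  field_simp

/-! ### The extremal bound -/

theorem inv_add_sq_eq {s : ℝ} (hs : 0 < s) (t : ℝ) :
    1 / (s + t ^ 2) = 1 / s * (1 + (t / √s) ^ 2)⁻¹ := by
  rw [div_pow, Real.sq_sqrt hs.le]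
  have : 0 < s + t ^ 2 := by positivity
  field_simp

theorem integrable_one_div_add_sq {s : ℝ} (hs : 0 < s) : Integrable fun t : ℝ => 1 / (s + t ^ 2) := by
  simp only [inv_add_sq_eq hs]
  exact (integrable_inv_one_add_sq.comp_div (Real.sqrt_pos.2 hs).ne').const_mul _

theorem integral_one_div_add_sq {s : ℝ} (hs : 0 < s) : ∫ t : ℝ, 1 / (s + t ^ 2) = Real.pi / √s := by
  simp only [inv_add_sq_eq hs]
  rw [integral_const_mul, Measure.integral_comp_div (fun t : ℝ => (1 + t ^ 2)⁻¹),
    integral_univ_inv_one_add_sq, abs_of_pos (Real.sqrt_pos.2 hs), smul_eq_mul]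
  have h := Real.sqrt_pos.2 hs
  field_simp
  rw [Real.sq_sqrt hs.le]

/-- The polynomial of degree at most `2 c - 2` that interpolates `1 / (1 + t² - x²)` to second order
at the roots of the Legendre polynomial, together with the interpolation error. -/
theorem exists_hermite_interpolant {c : ℕ} (hc : 1 ≤ c) {t : ℝ} (ht : t ≠ 0) :
    ∃ H : ℝ[X], ∃ a : ℝ, H.degree < (2 * c - 1 : ℕ) ∧ 0 < a ∧ ∀ x ∈ Set.Icc (-1 : ℝ) 1,
      1 / (1 - x ^ 2 + t ^ 2) =
        H.eval x + a * ((legendre c).eval x ^ 2 / (1 - x ^ 2 + t ^ 2)) := by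
  have ht2 : 0 < t ^ 2 := by positivity
  set z := √(1 + t ^ 2) with hz
  have hz2 : z ^ 2 = 1 + t ^ 2 := Real.sq_sqrt (by positivity)
  have hz1 : 1 < z := by rw [hz, Real.lt_sqrt (by norm_num)]; linarith
  have hPz : (legendre c).eval z ≠ 0 := fun h =>
    (nodes_subset (mem_nodes.2 h)).2.not_gt hz1
  -- `z` and `-z` are the poles of the kernel, and `P_c(-z)² = P_c(z)²`, so `P_c(z)² - P_c²` is
  -- divisible by `X² - z²`. The quotient `B` has degree at most `2 c - 2` and, divided by
  -- `-P_c(z)²`, is the interpolant.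
  set N : ℝ[X] := Polynomial.C ((legendre c).eval z ^ 2) - legendre c ^ 2 with hN
  obtain ⟨A, hA⟩ := dvd_iff_isRoot.2 (show N.IsRoot z by simp [hN])
  have hAz : A.IsRoot (-z) := by
    have h : N.eval (-z) = 0 := by simp [hN, eval_neg_legendre_sq]
    rw [hA, eval_mul, eval_sub, eval_X, eval_C] at h
    exact (mul_eq_zero.1 h).resolve_left (by linarith)
  obtain ⟨B, hB⟩ := dvd_iff_isRoot.2 hAz
  have hNB : N = (X - Polynomial.C z) * ((X - Polynomial.C (-z)) * B) := by rw [hA, hB]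
  refine ⟨Polynomial.C (-1 / (legendre c).eval z ^ 2) * B, 1 / (legendre c).eval z ^ 2, ?_,
    by positivity, fun x hx => ?_⟩
  · refine (degree_C_mul_of_isUnit (IsUnit.mk0 _ (by simp [hPz])) B).trans_lt ?_
    rcases eq_or_ne B 0 with rfl | hB0
    · rw [degree_zero]; exact WithBot.bot_lt_coe _
    · refine (natDegree_lt_iff_degree_lt hB0).1 ?_
      have h1 : N.natDegree ≤ 2 * c := by
        refine (natDegree_sub_le _ _).trans (max_le (by simp) ?_)
        rw [natDegree_pow, natDegree_legendre]
      rw [hNB, natDegree_mul (X_sub_C_ne_zero _) (mul_ne_zero (X_sub_C_ne_zero _) hB0),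
        natDegree_mul (X_sub_C_ne_zero _) hB0, natDegree_X_sub_C, natDegree_X_sub_C] at h1
      omega
  · have hx2 : 0 < 1 - x ^ 2 + t ^ 2 := by nlinarith [hx.1, hx.2]
    have h := congrArg (eval x) hNB
    simp only [hN, eval_sub, eval_C, eval_pow, eval_mul, eval_X] at h
    rw [eval_mul, eval_C]
    field_simp
    linear_combination h - B.eval x * hz2

/-- The quadrature rule is a lower bound for the integral of `1 / (1 + t² - x²)`. -/
theorem HasMoments.integral_kernel {c C : ℕ} (hc : 1 ≤ c) (hC : 2 * c - 1 ≤ C) {μ : Measure ℝ}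
    (hμ : IsBiasDistribution μ) {κ : ℝ} (h : HasMoments C μ κ) {t : ℝ} (ht : t ≠ 0) :
    ∃ a > 0, ∫ p, √(p * (1 - p)) * (1 / (1 - (2 * p - 1) ^ 2 + t ^ 2)) ∂μ =
      κ / 2 * ∑ x ∈ nodes c, gaussWeight c x * (1 / (1 - x ^ 2 + t ^ 2)) +
      a * ∫ p, √(p * (1 - p)) *
        ((legendre c).eval (2 * p - 1) ^ 2 / (1 - (2 * p - 1) ^ 2 + t ^ 2)) ∂μ := by
  obtain ⟨H, a, hH, ha, hHx⟩ := exists_hermite_interpolant hc ht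
  refine ⟨a, ha, ?_⟩
  have ht2 : 0 < t ^ 2 := by positivity
  have hden : ∀ p ∈ Set.Icc (0 : ℝ) 1, 1 - (2 * p - 1) ^ 2 + t ^ 2 ≠ 0 := fun p hp => by
    nlinarith [hp.1, hp.2]
  have hQ : ∑ x ∈ nodes c, gaussWeight c x * (1 / (1 - x ^ 2 + t ^ 2)) =
      ∫ x in (-1 : ℝ)..1, H.eval x := by
    rw [gauss_quadrature (hH.trans (by exact_mod_cast (by omega : 2 * c - 1 < 2 * c)))]
    refine Finset.sum_congr rfl fun x hx => ?_
    rw [hHx x (Set.Ioo_subset_Icc_self (nodes_subset hx)), mem_nodes.1 hx]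
    simp
  have hcomp : ∀ p : ℝ, (H.comp (Polynomial.C 2 * X - 1)).eval p = H.eval (2 * p - 1) := fun p => by
    simp
  have hM := h (H.comp (Polynomial.C 2 * X - 1))
    (degree_comp_lt (hH.trans_le (by exact_mod_cast hC)) (by compute_degree))
  have hI := integral_comp_point fun p => H.eval (2 * p - 1)
  simp only [point, mul_div_cancel₀ _ (two_ne_zero' ℝ), add_sub_cancel_right] at hI
  rw [biasIntegral] at hM
  simp only [hcomp] at hM
  rw [hQ, hI, show κ / 2 * (2 * ∫ p in (0 : ℝ)..1, H.eval (2 * p - 1)) =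
    κ * ∫ p in (0 : ℝ)..1, H.eval (2 * p - 1) by ring, ← hM, ← integral_const_mul, ← integral_add]
  · refine integral_congr_ae ?_
    filter_upwards [hμ.ae_mem] with p hp
    rw [hHx (2 * p - 1) (by constructor <;> linarith [hp.1, hp.2])]
    ring
  · exact hμ.integrable_of_continuousOn (by fun_prop)
  · exact (hμ.integrable_of_continuousOn
      (ContinuousOn.mul (by fun_prop) (ContinuousOn.div (by fun_prop) (by fun_prop) hden))).const_mul _

theorem integrable_kernel {μ : Measure ℝ} (hμ : IsBiasDistribution μ) {t : ℝ} (ht : t ≠ 0) :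
    Integrable (fun p => √(p * (1 - p)) * (1 / (1 - (2 * p - 1) ^ 2 + t ^ 2))) μ := by
  have ht2 : 0 < t ^ 2 := by positivity
  exact hμ.integrable_of_continuousOn (ContinuousOn.mul (by fun_prop)
    (ContinuousOn.div (by fun_prop) (by fun_prop) fun p hp => by nlinarith [hp.1, hp.2]))

theorem kernel_nonneg {p : ℝ} (hp : p ∈ Set.Icc (0 : ℝ) 1) (t : ℝ) :
    0 ≤ √(p * (1 - p)) * (1 / (1 - (2 * p - 1) ^ 2 + t ^ 2)) := by
  have : 0 ≤ 1 - (2 * p - 1) ^ 2 + t ^ 2 := by nlinarith [hp.1, hp.2, sq_nonneg t]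
  positivity

theorem ae_ne_zero : ∀ᵐ t : ℝ, t ≠ 0 := by
  simp [ae_iff]

/-- By Tonelli's theorem the integral over `t` comes first. For `0 < p < 1` it is `π / (2 √(p (1 -
p)))` and cancels the prefactor; at `p = 0` and `p = 1` the prefactor is zero, so mass there is not
counted. -/
theorem lintegral_kernel {μ : Measure ℝ} (hμ : IsBiasDistribution μ) :
    ∫⁻ t, ENNReal.ofReal (∫ p, √(p * (1 - p)) * (1 / (1 - (2 * p - 1) ^ 2 + t ^ 2)) ∂μ) =
      ENNReal.ofReal (Real.pi / 2) * μ (Set.Ioo 0 1) := by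
  have := hμ.1
  have h1 : ∀ᵐ t : ℝ,
      ENNReal.ofReal (∫ p, √(p * (1 - p)) * (1 / (1 - (2 * p - 1) ^ 2 + t ^ 2)) ∂μ) =
      ∫⁻ p, ENNReal.ofReal (√(p * (1 - p)) * (1 / (1 - (2 * p - 1) ^ 2 + t ^ 2))) ∂μ := by
    filter_upwards [ae_ne_zero] with t ht
    refine ofReal_integral_eq_lintegral_ofReal (integrable_kernel hμ ht) ?_
    filter_upwards [hμ.ae_mem] with p hp using kernel_nonneg hp t
  rw [lintegral_congr_ae h1, lintegral_lintegral_swap (by fun_prop)]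
  have h2 : ∀ᵐ p ∂μ,
      ∫⁻ t, ENNReal.ofReal (√(p * (1 - p)) * (1 / (1 - (2 * p - 1) ^ 2 + t ^ 2))) =
      (Set.Ioo (0 : ℝ) 1).indicator (fun _ => ENNReal.ofReal (Real.pi / 2)) p := by
    filter_upwards [hμ.ae_mem] with p hp
    by_cases hp' : p ∈ Set.Ioo (0 : ℝ) 1
    · have hpos : 0 < p * (1 - p) := mul_pos hp'.1 (by linarith [hp'.2])
      have hs : 0 < 1 - (2 * p - 1) ^ 2 := by nlinarith
      rw [Set.indicator_of_mem hp', ← ofReal_integral_eq_lintegral_ofReal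
        ((integrable_one_div_add_sq hs).const_mul _) (.of_forall fun t => kernel_nonneg hp t),
        integral_const_mul, integral_one_div_add_sq hs,
        show 1 - (2 * p - 1) ^ 2 = 2 ^ 2 * (p * (1 - p)) by ring,
        Real.sqrt_mul (sq_nonneg (2 : ℝ)), Real.sqrt_sq (zero_le_two (α := ℝ))]
      have := Real.sqrt_pos.2 hpos
      congr 1
      field_simp
    · rw [Set.indicator_of_notMem hp']
      have : p * (1 - p) = 0 := by
        rcases hp.1.eq_or_lt with h | h
        · simp [← h]
        · rcases hp.2.eq_or_lt with h' | h'
          · simp [h']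
          · exact absurd ⟨h, h'⟩ hp'
      simp [this]
  rw [lintegral_congr_ae h2, lintegral_indicator_const measurableSet_Ioo]

/-- The integral over `t` divides each Gauss weight by `√(1 - x²)`, and this is how `N_c` appears.
-/
theorem lintegral_quadrature_kernel (c : ℕ) {κ : ℝ} (hκ : 0 ≤ κ) :
    ∫⁻ t : ℝ, ENNReal.ofReal (κ / 2 * ∑ x ∈ nodes c, gaussWeight c x * (1 / (1 - x ^ 2 + t ^ 2))) =
      ENNReal.ofReal (Real.pi / 2 * (κ * normConst c)) := by
  have hi : ∀ x ∈ nodes c, Integrable fun t : ℝ => gaussWeight c x * (1 / (1 - x ^ 2 + t ^ 2)) :=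
    fun x hx => (integrable_one_div_add_sq (one_sub_sq_pos (nodes_subset hx))).const_mul _
  rw [← ofReal_integral_eq_lintegral_ofReal ((integrable_finsetSum _ hi).const_mul _)]
  · rw [integral_const_mul, integral_finsetSum _ hi, normConst]
    congr 1
    have : ∀ x ∈ nodes c, ∫ t : ℝ, gaussWeight c x * (1 / (1 - x ^ 2 + t ^ 2)) =
        Real.pi * weight c x := fun x hx => by
      rw [integral_const_mul, integral_one_div_add_sq (one_sub_sq_pos (nodes_subset hx)),
        weight_eq hx]
      ring
    rw [Finset.sum_congr rfl this, ← Finset.mul_sum]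
    ring
  · refine .of_forall fun t => mul_nonneg (by positivity) (Finset.sum_nonneg fun x hx => ?_)
    have h1 := gaussWeight_pos hx
    have h2 := one_sub_sq_pos (nodes_subset hx)
    positivity

theorem ofReal_quadrature_le_integral_kernel {c C : ℕ} (hc : 1 ≤ c) (hC : 2 * c - 1 ≤ C)
    {μ : Measure ℝ} (hμ : IsBiasDistribution μ) {κ : ℝ} (h : HasMoments C μ κ) :
    ∀ᵐ t : ℝ, ENNReal.ofReal
        (κ / 2 * ∑ x ∈ nodes c, gaussWeight c x * (1 / (1 - x ^ 2 + t ^ 2))) ≤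
      ENNReal.ofReal (∫ p, √(p * (1 - p)) * (1 / (1 - (2 * p - 1) ^ 2 + t ^ 2)) ∂μ) := by
  filter_upwards [ae_ne_zero] with t ht
  obtain ⟨a, ha, hE⟩ := h.integral_kernel hc hC hμ ht
  refine ENNReal.ofReal_le_ofReal ?_
  rw [hE, le_add_iff_nonneg_right]
  refine mul_nonneg ha.le (integral_nonneg_of_ae ?_)
  filter_upwards [hμ.ae_mem] with p hp
  have : 0 ≤ 1 - (2 * p - 1) ^ 2 + t ^ 2 := by nlinarith [hp.1, hp.2, sq_nonneg t]
  simp only [Pi.zero_apply]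
  positivity

theorem HasMoments.mul_normConst_le_measure {c C : ℕ} (hc : 1 ≤ c) (hC : 2 * c - 1 ≤ C)
    {μ : Measure ℝ} (hμ : IsBiasDistribution μ) {κ : ℝ} (hκ : 0 ≤ κ) (h : HasMoments C μ κ) :
    ENNReal.ofReal (κ * normConst c) ≤ μ (Set.Ioo 0 1) := by
  have := lintegral_mono_ae (ofReal_quadrature_le_integral_kernel hc hC hμ h)
  rw [lintegral_kernel hμ, lintegral_quadrature_kernel c hκ,
    ENNReal.ofReal_mul (by positivity)] at this
  exact (ENNReal.mul_le_mul_iff_right (by simp [Real.pi_pos]) ENNReal.ofReal_ne_top).1 this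

theorem HasMoments.mul_normConst_le_one {c C : ℕ} (hc : 1 ≤ c) (hC : 2 * c - 1 ≤ C)
    {μ : Measure ℝ} (hμ : IsBiasDistribution μ) {κ : ℝ} (h : HasMoments C μ κ) :
    κ * normConst c ≤ 1 := by
  rcases le_or_gt κ 0 with hκ | hκ
  · exact (mul_nonpos_of_nonpos_of_nonneg hκ (normConst_pos hc).le).trans zero_le_one
  · have := hμ.1
    exact ENNReal.ofReal_le_one.1 ((h.mul_normConst_le_measure hc hC hμ hκ.le).trans prob_le_one)

/-- In the case of equality the distribution is concentrated on the Gauss–Legendre points. -/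
theorem HasMoments.ae_mem_points {c C : ℕ} (hc : 1 ≤ c) (hC : 2 * c - 1 ≤ C)
    {μ : Measure ℝ} (hμ : IsBiasDistribution μ) (h : HasMoments C μ (1 / normConst c)) :
    ∀ᵐ p ∂μ, p ∈ (nodes c).image point := by
  have := hμ.1
  have hN := normConst_pos hc
  have hκ : 1 / normConst c * normConst c = 1 := by field_simp
  have hκ0 : 0 ≤ 1 / normConst c := by positivity
  -- Equality excludes mass at 0 and 1, where the factor `√(p (1 - p))` would hide it.
  have hIoo : ∀ᵐ p ∂μ, p ∈ Set.Ioo (0 : ℝ) 1 := by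
    have h1 := h.mul_normConst_le_measure hc hC hμ hκ0
    rw [hκ, ENNReal.ofReal_one] at h1
    exact (mem_ae_iff_prob_eq_one measurableSet_Ioo).2 (le_antisymm prob_le_one h1)
  -- If the kernel bound were strict for all `t ≠ 0`, it would remain strict after integration over
  -- `t`, whereas the integral on the right is at most `π / 2`, the value on the left.
  obtain ⟨t, ht, hle⟩ : ∃ t : ℝ, t ≠ 0 ∧
      ∫ p, √(p * (1 - p)) * (1 / (1 - (2 * p - 1) ^ 2 + t ^ 2)) ∂μ ≤
      1 / normConst c / 2 * ∑ x ∈ nodes c, gaussWeight c x * (1 / (1 - x ^ 2 + t ^ 2)) := by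
    by_contra! H
    have hlt : ∫⁻ t : ℝ, ENNReal.ofReal
        (1 / normConst c / 2 * ∑ x ∈ nodes c, gaussWeight c x * (1 / (1 - x ^ 2 + t ^ 2))) <
        ∫⁻ t, ENNReal.ofReal
          (∫ p, √(p * (1 - p)) * (1 / (1 - (2 * p - 1) ^ 2 + t ^ 2)) ∂μ) := by
      refine lintegral_strict_mono (NeZero.ne _) ?_ ?_ ?_
      · refine (StronglyMeasurable.integral_prod_right (f := fun t p : ℝ =>
          √(p * (1 - p)) * (1 / (1 - (2 * p - 1) ^ 2 + t ^ 2))) ?_).measurable.ennreal_ofReal.aemeasurable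
        exact Measurable.stronglyMeasurable (by fun_prop)
      · rw [lintegral_quadrature_kernel c hκ0]; exact ENNReal.ofReal_ne_top
      · filter_upwards [ae_ne_zero] with t ht
        refine (ENNReal.ofReal_lt_ofReal_iff_of_nonneg ?_).2 (H t ht)
        refine mul_nonneg (by positivity) (Finset.sum_nonneg fun x hx => ?_)
        have h1 := gaussWeight_pos hx
        have h2 := one_sub_sq_pos (nodes_subset hx)
        positivity
    rw [lintegral_kernel hμ, lintegral_quadrature_kernel c hκ0, hκ, mul_one] at hlt
    exact hlt.not_ge (mul_le_of_le_one_right' prob_le_one)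
  obtain ⟨a, ha, hE⟩ := h.integral_kernel hc hC hμ ht
  have ht2 : 0 < t ^ 2 := by positivity
  have hnn : 0 ≤ᵐ[μ] fun p => √(p * (1 - p)) *
      ((legendre c).eval (2 * p - 1) ^ 2 / (1 - (2 * p - 1) ^ 2 + t ^ 2)) := by
    filter_upwards [hμ.ae_mem] with p hp
    have : 0 ≤ 1 - (2 * p - 1) ^ 2 + t ^ 2 := by nlinarith [hp.1, hp.2, sq_nonneg t]
    simp only [Pi.zero_apply]
    positivity
  have hint : Integrable (fun p => √(p * (1 - p)) *
      ((legendre c).eval (2 * p - 1) ^ 2 / (1 - (2 * p - 1) ^ 2 + t ^ 2))) μ :=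
    hμ.integrable_of_continuousOn (ContinuousOn.mul (by fun_prop)
      (ContinuousOn.div (by fun_prop) (by fun_prop) fun p hp => by nlinarith [hp.1, hp.2]))
  have hz : ∫ p, √(p * (1 - p)) *
      ((legendre c).eval (2 * p - 1) ^ 2 / (1 - (2 * p - 1) ^ 2 + t ^ 2)) ∂μ = 0 := by
    refine le_antisymm ?_ (integral_nonneg_of_ae hnn)
    rw [hE, add_le_iff_nonpos_right] at hle
    exact nonpos_of_mul_nonpos_right hle ha
  filter_upwards [hIoo, (integral_eq_zero_iff_of_nonneg_ae hnn hint).1 hz] with p hp hp0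
  have hpos : 0 < p * (1 - p) := mul_pos hp.1 (by linarith [hp.2])
  have hden : 1 - (2 * p - 1) ^ 2 + t ^ 2 ≠ 0 := by nlinarith
  have hP : (legendre c).eval (2 * p - 1) = 0 := by
    simpa [(Real.sqrt_pos.2 hpos).ne', hden] using hp0
  exact Finset.mem_image.2 ⟨2 * p - 1, mem_nodes.2 hP, by unfold point; ring⟩

/-! ### Uniqueness of the optimum -/

theorem ae_mem_points_gaussLegendreDist (c : ℕ) :
    ∀ᵐ p ∂gaussLegendreDist c, p ∈ (nodes c).image point := by
  have hm : MeasurableSet {p : ℝ | p ∈ (nodes c).image point}ᶜ :=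
    ((nodes c).image point).measurableSet.compl
  rw [ae_iff]
  refine (gaussLegendreDist_apply c hm).trans ?_
  rw [ENNReal.ofReal_eq_zero]
  refine (Finset.sum_eq_zero fun x hx => ?_).le
  rw [Set.indicator_of_notMem, mul_zero]
  simpa using ⟨x, hx, rfl⟩

/-- A bias distribution that is concentrated on the Gauss–Legendre points is determined by its
moments. -/
theorem HasMoments.eq_of_ae_mem_points {c C : ℕ} (hC : c ≤ C) {μ ν : Measure ℝ} {κ : ℝ}
    (hμ : IsBiasDistribution μ) (hν : IsBiasDistribution ν) (h : HasMoments C μ κ)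
    (h' : HasMoments C ν κ) (hμp : ∀ᵐ p ∂μ, p ∈ (nodes c).image point)
    (hνp : ∀ᵐ p ∂ν, p ∈ (nodes c).image point) : μ = ν := by
  have := hμ.1
  have := hν.1
  refine Measure.ext fun s hs => ?_
  set T := (nodes c).image point with hT
  -- On the nodes `√(p (1 - p)) r` is the indicator of `s`, so the mass of `s` becomes a moment of
  -- degree below `c`.
  set r := Lagrange.interpolate T id fun p => s.indicator 1 p / √(p * (1 - p)) with hr
  have hinj : Set.InjOn (id : ℝ → ℝ) T := Function.injective_id.injOn
  have hdeg : r.degree < C := by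
    refine (Lagrange.degree_interpolate_lt _ hinj).trans_le ?_
    have : T.card ≤ c := Finset.card_image_le.trans (card_nodes c).le
    exact_mod_cast this.trans hC
  have hval : ∀ p ∈ T, √(p * (1 - p)) * r.eval p = s.indicator 1 p := by
    intro p hp
    have h1 := Lagrange.eval_interpolate_at_node
      (fun p => s.indicator (1 : ℝ → ℝ) p / √(p * (1 - p))) hinj hp
    simp only [id] at h1
    rw [hr, h1]
    obtain ⟨x, hx, rfl⟩ := Finset.mem_image.1 hp
    have hp' := point_mem (nodes_subset hx)
    have := Real.sqrt_pos.2 (mul_pos hp'.1 (sub_pos.2 hp'.2))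
    field_simp
  have key : ∀ {ρ : Measure ℝ}, (∀ᵐ p ∂ρ, p ∈ T) → biasIntegral ρ r = ρ.real s := by
    intro ρ hρ
    rw [← integral_indicator_one hs, biasIntegral]
    refine integral_congr_ae ?_
    filter_upwards [hρ] with p hp using hval p hp
  have hfin := (key hμp).symm.trans (((h r hdeg).trans (h' r hdeg).symm).trans (key hνp))
  exact (measureReal_eq_measureReal_iff).1 hfin

theorem nonempty_pirateStrategy {C : ℕ} (hC : 1 ≤ C) : Nonempty (PirateStrategy C) :=
  ⟨unanimityStrategy Finset.univ ⟨⟨0, hC⟩, Finset.mem_univ _⟩⟩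

theorem isOptimal_iff {c C : ℕ} (hc : 1 ≤ c) (hC : C = 2 * c - 1 ∨ C = 2 * c) (μ : Measure ℝ) :
    IsOptimal C μ ↔ μ = gaussLegendreDist c := by
  have hN := normConst_pos hc
  have hg := isBiasDistribution_gaussLegendreDist hc
  have hgm : HasMoments C (gaussLegendreDist c) (1 / normConst c) :=
    hasMoments_gaussLegendreDist (by omega)
  have hgi : IsStrategyIndependent C (gaussLegendreDist c) := fun ρ ρ' => by
    rw [hgm.coalitionScore_eq hg, hgm.coalitionScore_eq hg]
  have hle : ∀ ν : Measure ℝ, IsBiasDistribution ν → IsStrategyIndependent C ν →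
      ∀ ρ : PirateStrategy C, coalitionScore ν ρ ≤ coalitionScore (gaussLegendreDist c) ρ := by
    intro ν hν hνi ρ
    have h1 := (hνi.hasMoments hν ρ).mul_normConst_le_one hc (by omega) hν
    rw [hgm.coalitionScore_eq hg, mul_one_div, le_div_iff₀ hN]
    linarith
  constructor
  · rintro ⟨hμ, hμi, hopt⟩
    obtain ⟨ρ⟩ := nonempty_pirateStrategy (C := C) (by omega)
    have heq := le_antisymm (hle μ hμ hμi ρ) (hopt _ hg hgi ρ)
    have hm := hμi.hasMoments hμ ρ
    rw [heq, hgm.coalitionScore_eq hg, mul_div_cancel_left₀ _ (two_ne_zero' ℝ)] at hm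
    exact hm.eq_of_ae_mem_points (c := c) (by omega) hμ hg hgm
      (hm.ae_mem_points hc (by omega) hμ) (ae_mem_points_gaussLegendreDist c)
  · rintro rfl
    exact ⟨hg, hgi, hle⟩

/-! ### The arcsine distribution -/

open Real

theorem arcsineCDF_of_nonpos {p : ℝ} (hp : p ≤ 0) : arcsineCDF p = 0 := by
  simp [arcsineCDF, Real.sqrt_eq_zero_of_nonpos hp]

theorem tendsto_arcsineStieltjes_atBot : Tendsto arcsineStieltjes atBot (𝓝 0) := by
  refine tendsto_const_nhds.congr' ?_
  filter_upwards [eventually_le_atBot 0] with p hp using (arcsineCDF_of_nonpos hp).symm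

/-- The arcsine distribution is the distribution of `sin² θ` for an angle `θ` that is uniformly
distributed on `[0, π / 2]`. -/
theorem arcsineDist_eq_map : arcsineDist =
    Measure.map (fun θ => sin θ ^ 2)
      (ENNReal.ofReal (2 / π) • volume.restrict (Set.Icc 0 (π / 2))) := by
  have hm : Measurable fun θ => sin θ ^ 2 := by fun_prop
  have : IsFiniteMeasure (ENNReal.ofReal (2 / π) • volume.restrict (Set.Icc 0 (π / 2))) :=
    Measure.smul_finite _ ENNReal.ofReal_ne_top
  symm
  refine Measure.ext_of_Iic _ _ fun p => ?_
  rw [Measure.map_apply hm measurableSet_Iic, arcsineDist,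
    StieltjesFunction.measure_Iic _ tendsto_arcsineStieltjes_atBot, sub_zero, Measure.smul_apply,
    Measure.restrict_apply (hm measurableSet_Iic), smul_eq_mul]
  change _ = ENNReal.ofReal (arcsineCDF p)
  rcases lt_or_ge p 0 with hp | hp
  · rw [arcsineCDF_of_nonpos hp.le, ENNReal.ofReal_zero]
    have : (fun θ => sin θ ^ 2) ⁻¹' Set.Iic p ∩ Set.Icc 0 (π / 2) = ∅ := by
      ext θ
      simp only [Set.mem_inter_iff, Set.mem_preimage, Set.mem_Iic, Set.mem_empty_iff_false,
        iff_false, not_and]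
      intro h
      nlinarith [sq_nonneg (sin θ)]
    rw [this, measure_empty, mul_zero]
  · have : (fun θ => sin θ ^ 2) ⁻¹' Set.Iic p ∩ Set.Icc 0 (π / 2) = Set.Icc 0 (arcsin √p) := by
      ext θ
      simp only [Set.mem_inter_iff, Set.mem_preimage, Set.mem_Iic, Set.mem_Icc]
      constructor
      · rintro ⟨h1, h2, h3⟩
        refine ⟨h2, ?_⟩
        rw [← arcsin_sin (by linarith [pi_pos]) h3]
        exact monotone_arcsin (Real.le_sqrt_of_sq_le h1)
      · rintro ⟨h1, h2⟩
        have h3 := h2.trans (arcsin_le_pi_div_two _)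
        refine ⟨?_, h1, h3⟩
        have h4 : sin θ ≤ √p := by
          rcases le_or_gt √p 1 with h | h
          · exact (sin_le_sin_of_le_of_le_pi_div_two (by linarith [pi_pos])
              (arcsin_le_pi_div_two _) h2).trans_eq
              (sin_arcsin (by linarith [Real.sqrt_nonneg p]) h)
          · exact (sin_le_one θ).trans h.le
        have h5 := sin_nonneg_of_nonneg_of_le_pi h1 (by linarith [pi_pos])
        calc sin θ ^ 2 ≤ √p ^ 2 := by gcongr
          _ = p := Real.sq_sqrt hp
    rw [this, Real.volume_Icc, sub_zero, ← ENNReal.ofReal_mul (by positivity), arcsineCDF]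

theorem integral_arcsineDist {f : ℝ → ℝ} (hf : Continuous f) :
    ∫ p, f p ∂arcsineDist = 2 / π * ∫ θ in (0 : ℝ)..π / 2, f (sin θ ^ 2) := by
  rw [arcsineDist_eq_map, integral_map (by fun_prop) hf.aestronglyMeasurable, integral_smul_measure,
    ENNReal.toReal_ofReal (by positivity), smul_eq_mul,
    intervalIntegral.integral_of_le (by positivity), integral_Icc_eq_integral_Ioc]

theorem isBiasDistribution_arcsineDist : IsBiasDistribution arcsineDist := by
  have hm : Measurable fun θ => sin θ ^ 2 := by fun_prop
  rw [arcsineDist_eq_map]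
  constructor
  · constructor
    rw [Measure.map_apply hm .univ, Set.preimage_univ, Measure.smul_apply, Measure.restrict_apply_univ,
      Real.volume_Icc, smul_eq_mul, ← ENNReal.ofReal_mul (by positivity), sub_zero,
      show 2 / π * (π / 2) = 1 by field_simp, ENNReal.ofReal_one]
  · rw [Measure.map_apply hm measurableSet_Icc.compl]
    convert measure_empty (μ := ENNReal.ofReal (2 / π) • volume.restrict (Set.Icc 0 (π / 2)))
    ext θ
    simp [abs_sin_le_one, sq_nonneg]

/-- Under `p = sin² θ` one has `√(p (1 - p)) = sin θ cos θ` and `dp = 2 sin θ cos θ dθ`, so the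
factor is, up to a constant, the Jacobian. -/
theorem hasMoments_arcsineDist (C : ℕ) : HasMoments C arcsineDist (1 / π) := by
  intro r _
  have hsub := intervalIntegral.integral_comp_mul_deriv (a := 0) (b := π / 2)
    (f := fun θ => sin θ ^ 2) (f' := fun θ => 2 * sin θ * cos θ) (g := fun p => r.eval p)
    (fun θ _ => by simpa [Pi.pow_def] using (hasDerivAt_sin θ).pow 2) (by fun_prop) r.continuous
  simp only [Function.comp_apply, sin_zero, sin_pi_div_two, one_pow, ne_eq, OfNat.ofNat_ne_zero,
    not_false_eq_true, zero_pow] at hsub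
  rw [biasIntegral, integral_arcsineDist (by fun_prop), ← hsub,
    ← intervalIntegral.integral_const_mul, ← intervalIntegral.integral_const_mul]
  refine intervalIntegral.integral_congr fun θ hθ => ?_
  rw [Set.uIcc_of_le (by positivity)] at hθ
  have h1 := sin_nonneg_of_nonneg_of_le_pi hθ.1 (by linarith [pi_pos, hθ.2])
  have h2 := cos_nonneg_of_neg_pi_div_two_le_of_le (by linarith [pi_pos, hθ.1]) hθ.2
  rw [show sin θ ^ 2 * (1 - sin θ ^ 2) = (sin θ * cos θ) ^ 2 by rw [← cos_sq']; ring,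
    Real.sqrt_sq (mul_nonneg h1 h2)]
  ring

/-- The extremal bound is applied to the arcsine distribution as a competitor. -/
theorem normConst_le_pi {c : ℕ} (hc : 1 ≤ c) : normConst c ≤ π := by
  have := (hasMoments_arcsineDist (2 * c)).mul_normConst_le_one hc (by omega)
    isBiasDistribution_arcsineDist
  rwa [one_div_mul_eq_div, div_le_one pi_pos] at this

/-! ### Convergence of the distribution functions -/

/-- The Gauss–Legendre quadrature rules converge for every continuous function. -/
theorem tendsto_quadrature {g : ℝ → ℝ} (hg : ContinuousOn g (Set.Icc (-1) 1)) :
    Tendsto (fun c => ∑ x ∈ nodes c, gaussWeight c x * g x) atTop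
      (𝓝 (∫ x in (-1 : ℝ)..1, g x)) := by
  rw [Metric.tendsto_atTop]
  intro ε hε
  -- The quadrature and the integral each have total mass 2, so replacing `g` by `q` costs at most
  -- `4 ε / 5` in all.
  obtain ⟨q, hq⟩ := exists_polynomial_near_of_continuousOn (-1) 1 g hg (ε / 5)
    (by positivity)
  refine ⟨q.natDegree + 1, fun c hc => ?_⟩
  have hQ := gauss_quadrature (c := c) (r := q)
    (degree_le_natDegree.trans_lt (by exact_mod_cast (by omega : q.natDegree < 2 * c)))
  have h1 := gauss_quadrature (c := c) (r := 1) (by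
    rw [degree_one]; exact_mod_cast (by omega : 0 < 2 * c))
  simp only [eval_one, mul_one, intervalIntegral.integral_const, smul_eq_mul] at h1
  have e1 : |∑ x ∈ nodes c, gaussWeight c x * g x - ∑ x ∈ nodes c, gaussWeight c x * q.eval x|
      ≤ 2 * (ε / 5) := by
    rw [← Finset.sum_sub_distrib]
    refine (Finset.abs_sum_le_sum_abs _ _).trans ?_
    rw [show (2 : ℝ) = ∑ x ∈ nodes c, gaussWeight c x by rw [← h1]; norm_num, Finset.sum_mul]
    refine Finset.sum_le_sum fun x hx => ?_
    rw [← mul_sub, abs_mul, abs_of_pos (gaussWeight_pos hx), abs_sub_comm]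
    exact mul_le_mul_of_nonneg_left
      (hq x (Set.Ioo_subset_Icc_self (nodes_subset hx))).le (gaussWeight_pos hx).le
  have e2 : |∫ x in (-1 : ℝ)..1, (q.eval x - g x)| ≤ ε / 5 * |1 - (-1)| := by
    rw [← Real.norm_eq_abs]
    refine intervalIntegral.norm_integral_le_of_norm_le_const fun x hx => ?_
    rw [Set.uIoc_of_le (by norm_num)] at hx
    exact (hq x (Set.Ioc_subset_Icc_self hx)).le
  rw [intervalIntegral.integral_sub (intervalIntegrable_eval _ _ _)
    (hg.intervalIntegrable_of_Icc (by norm_num)),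
    hQ] at e2
  norm_num at e2
  rw [Real.dist_eq]
  rw [abs_le] at e1 e2
  rw [abs_lt]
  constructor <;> linarith

/-- A bounded approximation from below to `1 / √(1 - x²)` on `[-1, 1]`. -/
def smoothedDensity (δ x : ℝ) : ℝ := 1 / √(1 + δ - x ^ 2)

theorem one_add_sub_sq_pos {δ x : ℝ} (hδ : 0 < δ) (hx : x ∈ Set.Icc (-1 : ℝ) 1) :
    0 < 1 + δ - x ^ 2 := by nlinarith [hx.1, hx.2]

theorem continuousOn_smoothedDensity {δ : ℝ} (hδ : 0 < δ) :
    ContinuousOn (smoothedDensity δ) (Set.Icc (-1) 1) :=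
  ContinuousOn.div (by fun_prop) (by fun_prop) fun _ hx =>
    (Real.sqrt_pos.2 (one_add_sub_sq_pos hδ hx)).ne'

theorem hasDerivAt_arcsin_div {δ x : ℝ} (hδ : 0 < δ) (hx : x ∈ Set.Icc (-1 : ℝ) 1) :
    HasDerivAt (fun x => arcsin (x / √(1 + δ))) (smoothedDensity δ x) x := by
  have h1 : 0 < 1 + δ := by linarith
  have hs := Real.sqrt_pos.2 h1
  have h2 := one_add_sub_sq_pos hδ hx
  have hs1 : 1 < √(1 + δ) := by rw [Real.lt_sqrt (by norm_num)]; linarith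
  have h3 : x / √(1 + δ) ≠ -1 := by
    rw [Ne, div_eq_iff hs.ne']; linarith [hx.1]
  have h4 : x / √(1 + δ) ≠ 1 := by
    rw [Ne, div_eq_iff hs.ne']; linarith [hx.2]
  have h := (hasDerivAt_arcsin h3 h4).comp x ((hasDerivAt_id x).div_const √(1 + δ))
  refine h.congr_deriv ?_
  rw [div_pow, Real.sq_sqrt h1.le,
    show 1 - x ^ 2 / (1 + δ) = (1 + δ - x ^ 2) / (1 + δ) by field_simp, Real.sqrt_div h2.le, smoothedDensity]
  field_simp

theorem integral_smoothedDensity {δ : ℝ} (hδ : 0 < δ) {a b : ℝ} (ha : -1 ≤ a) (hab : a ≤ b)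
    (hb : b ≤ 1) :
    ∫ x in a..b, smoothedDensity δ x = arcsin (b / √(1 + δ)) - arcsin (a / √(1 + δ)) := by
  have hsub : Set.uIcc a b ⊆ Set.Icc (-1) 1 := by
    rw [Set.uIcc_of_le hab]; exact Set.Icc_subset_Icc ha hb
  exact intervalIntegral.integral_eq_sub_of_hasDerivAt
    (fun x hx => hasDerivAt_arcsin_div hδ (hsub hx))
    ((continuousOn_smoothedDensity hδ).mono hsub).intervalIntegrable

/-- Asymptotically the weights of the nodes in an interval are not smaller than its arcsine
measure. -/
theorem eventually_lt_sum_weight {u v : ℝ} (hu : -1 ≤ u) (huv : u < v) (hv : v ≤ 1) {y : ℝ}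
    (hy : y < arcsin v - arcsin u) :
    ∀ᶠ c : ℕ in atTop, y < ∑ x ∈ nodes c with x ∈ Set.Ioo u v, weight c x := by
  -- A single `η` serves as the margin at both ends of the interval and as the smoothing parameter.
  obtain ⟨η, hη, hη2, hyη⟩ : ∃ η > 0, 2 * η < v - u ∧
      y < arcsin ((v - η) / √(1 + η)) - arcsin ((u + η) / √(1 + η)) := by
    have hcont : ContinuousAt
        (fun η => arcsin ((v - η) / √(1 + η)) - arcsin ((u + η) / √(1 + η))) 0 := by
      have hd : ∀ f : ℝ → ℝ, Continuous f → ContinuousAt (fun η => arcsin (f η / √(1 + η))) 0 :=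
        fun f hf => continuous_arcsin.continuousAt.comp (f := fun η => f η / √(1 + η))
          (hf.continuousAt.div (by fun_prop) (by simp))
      exact (hd _ (by fun_prop)).sub (hd _ (by fun_prop))
    have h1 : ∀ᶠ η in 𝓝[>] (0 : ℝ),
        y < arcsin ((v - η) / √(1 + η)) - arcsin ((u + η) / √(1 + η)) :=
      nhdsWithin_le_nhds (hcont.eventually_const_lt (by simpa using hy))
    have h2 : ∀ᶠ η in 𝓝[>] (0 : ℝ), 2 * η < v - u :=
      nhdsWithin_le_nhds ((show ContinuousAt (fun η : ℝ => 2 * η) 0 by fun_prop).eventually_lt_const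
        (by simpa using huv))
    obtain ⟨η, h3, h4, h5⟩ := (h1.and (h2.and self_mem_nhdsWithin)).exists
    exact ⟨η, h5, h4, h3⟩
  -- A trapezoidal cutoff makes the integrand continuous, as convergence of the quadrature requires.
  set χ : ℝ → ℝ := fun x => min 1 (max 0 (min ((x - u) / η) ((v - x) / η))) with hχ
  have hχ0 : ∀ x, 0 ≤ χ x := fun x => le_min zero_le_one (le_max_left _ _)
  have hχ1 : ∀ x, χ x ≤ 1 := fun x => min_le_left _ _
  have hχc : Continuous χ := by fun_prop
  have hχin : ∀ x ∈ Set.Icc (u + η) (v - η), χ x = 1 := fun x hx => by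
    refine min_eq_left (le_max_of_le_right (le_min ?_ ?_)) <;>
    · rw [le_div_iff₀ hη]; linarith [hx.1, hx.2]
  have hχout : ∀ x ∉ Set.Ioo u v, χ x = 0 := fun x hx => by
    have hm : min ((x - u) / η) ((v - x) / η) ≤ 0 := by
      rcases not_and_or.1 hx with h | h
      · exact min_le_of_left_le (div_nonpos_of_nonpos_of_nonneg (by linarith) hη.le)
      · exact min_le_of_right_le (div_nonpos_of_nonpos_of_nonneg (by linarith) hη.le)
    simp [hχ, max_eq_left hm]
  have hgc : ContinuousOn (fun x => χ x * smoothedDensity η x) (Set.Icc (-1) 1) :=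
    hχc.continuousOn.mul (continuousOn_smoothedDensity hη)
  have hgn : ∀ x, 0 ≤ χ x * smoothedDensity η x := fun x =>
    mul_nonneg (hχ0 x) (one_div_nonneg.2 (Real.sqrt_nonneg _))
  have hint : y < ∫ x in (-1 : ℝ)..1, χ x * smoothedDensity η x := by
    refine hyη.trans_le ?_
    rw [← integral_smoothedDensity hη (by linarith) (by linarith) (by linarith)]
    have heq : ∫ x in (u + η)..(v - η), smoothedDensity η x =
        ∫ x in (u + η)..(v - η), χ x * smoothedDensity η x := by
      refine intervalIntegral.integral_congr fun x hx => ?_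
      rw [Set.uIcc_of_le (by linarith)] at hx
      simp only [hχin x hx, one_mul]
    rw [heq]
    exact intervalIntegral.integral_mono_interval (by linarith) (by linarith) (by linarith)
      (.of_forall hgn) (hgc.intervalIntegrable_of_Icc (by norm_num))
  filter_upwards [(tendsto_quadrature hgc).eventually_const_lt hint] with c hc
  refine hc.trans_le ?_
  rw [Finset.sum_filter]
  refine Finset.sum_le_sum fun x hx => ?_
  split_ifs with hxuv
  · rw [weight_eq hx, div_eq_mul_one_div]
    have hpos := one_sub_sq_pos (nodes_subset hx)
    refine mul_le_mul_of_nonneg_left ?_ (gaussWeight_pos hx).le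
    refine (mul_le_of_le_one_left (one_div_nonneg.2 (Real.sqrt_nonneg _)) (hχ1 x)).trans ?_
    exact one_div_le_one_div_of_le (Real.sqrt_pos.2 hpos) (Real.sqrt_le_sqrt (by linarith))
  · rw [hχout x hxuv]
    simp

/-- If `p = sin² α`, then `2 p - 1 = -cos (2 α) = sin (2 α - π / 2)`. -/
theorem arcsin_two_mul_sub_one {p : ℝ} (hp : p ∈ Set.Icc (0 : ℝ) 1) :
    arcsin (2 * p - 1) + π / 2 = π * arcsineCDF p := by
  have h0 : 0 ≤ arcsin √p := arcsin_nonneg.2 (Real.sqrt_nonneg p)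
  have h1 := arcsin_le_pi_div_two √p
  have h2 : sin (arcsin √p) = √p :=
    sin_arcsin (by linarith [Real.sqrt_nonneg p]) (Real.sqrt_le_one.2 hp.2)
  have h3 : sin (2 * arcsin √p - π / 2) = 2 * p - 1 := by
    rw [sin_sub_pi_div_two, cos_two_mul', cos_sq', h2, Real.sq_sqrt hp.1]; ring
  rw [← h3, arcsin_sin (by linarith) (by linarith), arcsineCDF]
  field_simp
  ring

/-- The weights left and right of `a` are asymptotically at least `L` and `π - L`, while their total
is at most `π`. This squeezes both the partial sum and `N_c`. -/
theorem tendsto_gaussLegendreCDF {p : ℝ} (hp : p ∈ Set.Ioo (0 : ℝ) 1) :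
    Tendsto (fun c : ℕ => gaussLegendreCDF c p) atTop (𝓝 (arcsineCDF p)) := by
  set a := 2 * p - 1 with ha
  have ha1 : -1 < a := by linarith [hp.1]
  have ha2 : a < 1 := by linarith [hp.2]
  set L := arcsin a + π / 2 with hL
  have hlow : ∀ y < L, ∀ᶠ c : ℕ in atTop, y < ∑ x ∈ nodes c with x ∈ Set.Ioo (-1) a, weight c x :=
    fun y hy => eventually_lt_sum_weight le_rfl ha1 ha2.le (by simpa [arcsin_neg_one] using hy)
  have hhigh : ∀ y < π - L, ∀ᶠ c : ℕ in atTop,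
      y < ∑ x ∈ nodes c with x ∈ Set.Ioo a 1, weight c x :=
    fun y hy => eventually_lt_sum_weight ha1.le ha2 le_rfl (by rw [arcsin_one]; linarith)
  set S : ℕ → ℝ := fun c => ∑ x ∈ nodes c with x ≤ a, weight c x with hS
  have hSlow : ∀ c, ∑ x ∈ nodes c with x ∈ Set.Ioo (-1) a, weight c x ≤ S c := fun c =>
    Finset.sum_le_sum_of_subset_of_nonneg
      (Finset.monotone_filter_right _ fun x _ hx => hx.2.le)
      fun x hx _ => (weight_pos (Finset.mem_filter.1 hx).1).le
  have hSN : ∀ c, normConst c = S c + ∑ x ∈ nodes c with x ∈ Set.Ioo a 1, weight c x := fun c => by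
    rw [normConst, ← Finset.sum_filter_add_sum_filter_not _ (fun x => x ≤ a)]
    congr 1
    refine Finset.sum_congr (Finset.filter_congr fun x hx => ?_) fun _ _ => rfl
    simp [(nodes_subset hx).2]
  have hN : Tendsto normConst atTop (𝓝 π) := by
    refine tendsto_order.2 ⟨fun y hy => ?_, fun y hy => ?_⟩
    · filter_upwards [hlow (L - (π - y) / 2) (by linarith), hhigh (π - L - (π - y) / 2) (by linarith)]
        with c h1 h2
      linarith [hSlow c, hSN c]
    · filter_upwards [eventually_ge_atTop 1] with c hc using (normConst_le_pi hc).trans_lt hy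
  have hSt : Tendsto S atTop (𝓝 L) := by
    refine tendsto_order.2 ⟨fun y hy => ?_, fun y hy => ?_⟩
    · filter_upwards [hlow y hy] with c h1 using h1.trans_le (hSlow c)
    · filter_upwards [hhigh (π - y) (by linarith), eventually_ge_atTop 1] with c h1 hc
      linarith [hSN c, normConst_le_pi hc]
  have hCDF : ∀ c, gaussLegendreCDF c p = S c / normConst c := fun c => by
    rw [gaussLegendreCDF, one_div_mul_eq_div]
    congr 1
    simp only [hS, Finset.sum_filter]
    refine Finset.sum_congr rfl fun x _ => ?_
    have : 0 ≤ p - point x ↔ x ≤ a := by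
      unfold point; constructor <;> intro h <;> linarith
    simp only [heaviside, this]
    split_ifs <;> simp
  simp only [hCDF]
  have := hSt.div hN pi_ne_zero
  rwa [hL, arcsin_two_mul_sub_one (Set.Ioo_subset_Icc_self hp), mul_div_cancel_left₀ _ pi_ne_zero] at this

/-! ### Strategies from Bernstein polynomials -/

/-- The strategy that outputs `1` with the probability `G (k / C)` when `k` of the `C` colluders
received `1`. -/
def proportionStrategy {C : ℕ} (hC : 1 ≤ C) (G : ℝ → ℝ)
    
    (hG : ∀ p ∈ Set.Icc (0 : ℝ) 1, G p ∈ Set.Icc (0 : ℝ) 1)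
    (hG0 : G 0 = 0) (hG1 : G 1 = 1) : PirateStrategy C where
  probOne x := G ((Finset.univ.filter fun j => x j = true).card / C)
  probOne_mem x := hG _ ⟨by positivity, div_le_one_of_le₀
    (by exact_mod_cast (Finset.card_le_univ _).trans (by simp)) (by positivity)⟩
  probOne_ones := by
    have : (C : ℝ) ≠ 0 := by positivity
    simp [this, hG1]
  probOne_zeros := by simp [hG0]

theorem columnPoly_eq {C : ℕ} (x : Fin C → Bool) :
    columnPoly x = X ^ (Finset.univ.filter fun j => x j = true).card *
      (1 - X) ^ (C - (Finset.univ.filter fun j => x j = true).card) := by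
  rw [columnPoly, Finset.prod_ite, Finset.prod_const, Finset.prod_const]
  congr 2
  have := Finset.card_filter_add_card_filter_not (s := (Finset.univ : Finset (Fin C))) (fun j => x j = true)
  simp only [Finset.card_univ, Fintype.card_fin] at this
  omega

theorem sum_apply_card {C : ℕ} {M : Type*} [AddCommMonoid M] (f : ℕ → M) :
    ∑ x : Fin C → Bool, f (Finset.univ.filter fun j => x j = true).card =
      ∑ k ∈ Finset.range (C + 1), C.choose k • f k := by
  have h := Finset.sum_powerset_apply_card f (x := (Finset.univ : Finset (Fin C)))
  rw [Finset.card_univ, Fintype.card_fin, Finset.powerset_univ] at h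
  rw [← h]
  refine Finset.sum_bij' (fun x _ => Finset.univ.filter fun j => x j = true)
    (fun T _ j => decide (j ∈ T)) (by simp) (by simp) (by simp) (by simp) (by simp)

theorem outputPoly_proportionStrategy {C : ℕ} (hC : 1 ≤ C) (G : ℝ → ℝ) (hG) (hG0 : G 0 = 0)
    (hG1 : G 1 = 1) : outputPoly (proportionStrategy hC G hG hG0 hG1) =
      ∑ k ∈ Finset.range (C + 1), Polynomial.C (G (k / C)) * bernsteinPolynomial ℝ C k := by
  simp only [outputPoly, proportionStrategy, columnPoly_eq]
  rw [sum_apply_card fun k => Polynomial.C (G (k / C)) * (X ^ k * (1 - X) ^ (C - k))]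
  refine Finset.sum_congr rfl fun k _ => ?_
  rw [bernsteinPolynomial, nsmul_eq_mul]
  ring

/-- Summation by parts, since the derivative of a Bernstein polynomial of degree `n + 1` is `n + 1`
times a difference of two neighbours of degree `n`. -/
theorem derivative_sum_bernsteinPolynomial (n : ℕ) (a : ℕ → ℝ) :
    derivative (∑ k ∈ Finset.range (n + 2), Polynomial.C (a k) * bernsteinPolynomial ℝ (n + 1) k) =
      ∑ k ∈ Finset.range (n + 1),
        Polynomial.C ((n + 1) * (a (k + 1) - a k)) * bernsteinPolynomial ℝ n k := by
  have h0 : bernsteinPolynomial ℝ n (n + 1) = 0 := bernsteinPolynomial.eq_zero_of_lt ℝ (by omega)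
  have h1 := Finset.sum_range_succ (fun k => Polynomial.C (a k) * bernsteinPolynomial ℝ n k) (n + 1)
  have h2 := Finset.sum_range_succ' (fun k => Polynomial.C (a k) * bernsteinPolynomial ℝ n k) (n + 1)
  rw [h0, mul_zero, add_zero] at h1
  rw [h1] at h2
  rw [Finset.sum_range_succ']
  simp only [derivative_add, derivative_sum, derivative_C_mul, bernsteinPolynomial.derivative_succ,
    bernsteinPolynomial.derivative_zero, Nat.add_sub_cancel]
  have h3 : ∀ k, Polynomial.C ((n + 1) * (a (k + 1) - a k)) * bernsteinPolynomial ℝ n k =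
      ((n : ℝ[X]) + 1) * (Polynomial.C (a (k + 1)) * bernsteinPolynomial ℝ n k) -
      ((n : ℝ[X]) + 1) * (Polynomial.C (a k) * bernsteinPolynomial ℝ n k) := fun k => by
    simp only [map_mul, map_add, map_sub, map_natCast, map_one]; ring
  have h4 : ∀ k, Polynomial.C (a (k + 1)) * (((n + 1 : ℕ) : ℝ[X]) *
      (bernsteinPolynomial ℝ n k - bernsteinPolynomial ℝ n (k + 1))) =
      ((n : ℝ[X]) + 1) * (Polynomial.C (a (k + 1)) * bernsteinPolynomial ℝ n k) -
      ((n : ℝ[X]) + 1) * (Polynomial.C (a (k + 1)) * bernsteinPolynomial ℝ n (k + 1)) := fun k => by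
    push_cast; ring
  simp only [h3, h4, Finset.sum_sub_distrib, ← Finset.mul_sum]
  rw [h2]
  push_cast
  ring

/-- The normalised difference quotients that define the derivative of a Bernstein approximation
are uniformly close to the derivative. -/
theorem eventually_difference_quotient {G φ : ℝ → ℝ}
    (hG : ∀ p ∈ Set.Icc (0 : ℝ) 1, HasDerivAt G (φ p) p) (hφ : ContinuousOn φ (Set.Icc 0 1))
    {η : ℝ} (hη : 0 < η) :
    ∀ᶠ n : ℕ in atTop, ∀ k ≤ n,
      ((n : ℝ) + 1) * (G ((k + 1 : ℕ) / (n + 1 : ℕ)) - G (k / (n + 1 : ℕ))) ≤ φ (k / n) + η := by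
  have huc := isCompact_Icc.uniformContinuousOn_of_continuous hφ
  obtain ⟨δ, hδ, hclose⟩ := Metric.uniformContinuousOn_iff.1 huc η hη
  obtain ⟨N, hN⟩ := exists_nat_gt (1 / δ)
  filter_upwards [eventually_ge_atTop (N + 1)] with n hn k hk
  have hn0 : (0 : ℝ) < n := by exact_mod_cast (by omega : 0 < n)
  have hkn : (k : ℝ) ≤ n := by exact_mod_cast hk
  have hk0 : (0 : ℝ) ≤ k := by positivity
  have hnN : (N : ℝ) + 1 ≤ n := by exact_mod_cast hn
  push_cast
  have hn1 : (0 : ℝ) < n + 1 := by positivity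
  have hlt : (k : ℝ) / (n + 1) < (k + 1) / (n + 1) := by gcongr; linarith
  have hlo : (0 : ℝ) ≤ k / (n + 1) := by positivity
  have hhi : ((k : ℝ) + 1) / (n + 1) ≤ 1 := by rw [div_le_one hn1]; linarith
  have hsub : Set.Icc ((k : ℝ) / (n + 1)) ((k + 1) / (n + 1)) ⊆ Set.Icc 0 1 :=
    Set.Icc_subset_Icc hlo hhi
  obtain ⟨ξ, hξ, hξe⟩ := exists_hasDerivAt_eq_slope G φ hlt
    (fun p hp => (hG p (hsub hp)).continuousAt.continuousWithinAt)
    (fun p hp => hG p (hsub (Set.Ioo_subset_Icc_self hp)))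
  have hdiff : ((k : ℝ) + 1) / (n + 1) - k / (n + 1) = 1 / (n + 1) := by ring
  rw [hdiff, div_div_eq_mul_div, div_one] at hξe
  rw [mul_comm, ← hξe]
  -- Both `k / n` and the mean value point `ξ` lie in the interval from `k / (n + 1)` to `(k + 1) /
  -- (n + 1)`, so they are close.
  have h1 : (k : ℝ) / (n + 1) ≤ k / n := by gcongr; linarith
  have h2 : (k : ℝ) / n ≤ (k + 1) / (n + 1) := by
    rw [div_le_div_iff₀ hn0 hn1]; nlinarith
  have hmem : (k : ℝ) / n ∈ Set.Icc (0 : ℝ) 1 := hsub ⟨h1, h2⟩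
  have hsmall : 1 / ((n : ℝ) + 1) < δ := by
    rw [div_lt_comm₀ hn1 hδ]; linarith
  have hd := hclose ξ (hsub (Set.Ioo_subset_Icc_self hξ)) _ hmem (by
    rw [Real.dist_eq, abs_lt]
    constructor <;> linarith [hξ.1, hξ.2])
  rw [Real.dist_eq, abs_lt] at hd
  linarith [hd.2]

/-- The derivative is a Bernstein sum of difference quotients of `G`. Half of `η` pays for replacing
these by the values `φ (k / n)`, the other half for Bernstein's approximation of `φ`. -/
theorem eventually_derivative_outputPoly_le {G φ : ℝ → ℝ} (hGm) (hG0 : G 0 = 0) (hG1 : G 1 = 1)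
    (hG : ∀ p ∈ Set.Icc (0 : ℝ) 1, HasDerivAt G (φ p) p) (hφ : ContinuousOn φ (Set.Icc 0 1))
    {η : ℝ} (hη : 0 < η) :
    ∀ᶠ n : ℕ in atTop, ∀ p ∈ Set.Icc (0 : ℝ) 1,
      (derivative (outputPoly (proportionStrategy (C := n + 1) (by omega) G hGm hG0 hG1))).eval p ≤
        φ p + η := by
  let f : C(unitInterval, ℝ) := ⟨fun p => φ p, hφ.domRestrict⟩
  have hb := Metric.tendsto_nhds.1 (bernsteinApproximation_uniform f) (η / 2) (by positivity)
  filter_upwards [eventually_difference_quotient hG hφ (half_pos hη), hb] with n hq hb p hp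
  rw [outputPoly_proportionStrategy,
    derivative_sum_bernsteinPolynomial n fun k => G (k / (n + 1 : ℕ)), eval_finsetSum]
  set q : unitInterval := ⟨p, hp⟩ with hq'
  have hsum := bernstein.probability n q
  have h1 := (ContinuousMap.dist_lt_iff (by positivity)).1 hb q
  have h2 : f q = φ p := rfl
  rw [h2, Real.dist_eq, abs_lt, bernsteinApproximation.apply] at h1
  have h3 : ∑ k ∈ Finset.range (n + 1), eval p (Polynomial.C (((n : ℝ) + 1) *
      (G ((k + 1 : ℕ) / (n + 1 : ℕ)) - G (k / (n + 1 : ℕ)))) * bernsteinPolynomial ℝ n k) ≤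
      ∑ k : Fin (n + 1), (bernstein n k q * f (bernstein.z k) + bernstein n k q * (η / 2)) := by
    rw [Finset.sum_range]
    refine Finset.sum_le_sum fun k _ => ?_
    have hk := hq k (Nat.lt_succ_iff.1 k.2)
    have e : f (bernstein.z k) = φ (k / n) := rfl
    have e2 : eval p (bernsteinPolynomial ℝ n k) = bernstein n k q := rfl
    rw [e, eval_mul, eval_C, e2, ← mul_add, mul_comm]
    exact mul_le_mul_of_nonneg_left hk bernstein_nonneg
  refine h3.trans ?_
  rw [Finset.sum_add_distrib, ← Finset.sum_mul, hsum]
  simp only [smul_eq_mul] at h1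
  linarith [h1.2]

theorem sqrt_mul_smoothedDensity_le {δ : ℝ} (hδ : 0 < δ) {p : ℝ} (hp : p ∈ Set.Icc (0 : ℝ) 1) :
    √(p * (1 - p)) * smoothedDensity δ (2 * p - 1) ≤ 1 / 2 := by
  have h : 2 * √(p * (1 - p)) ≤ √(1 + δ - (2 * p - 1) ^ 2) := by
    refine Real.le_sqrt_of_sq_le ?_
    rw [mul_pow, Real.sq_sqrt (mul_nonneg hp.1 (by linarith [hp.2]))]
    linarith
  have hpos := Real.sqrt_pos.2 (one_add_sub_sq_pos hδ
    (show 2 * p - 1 ∈ Set.Icc (-1 : ℝ) 1 by constructor <;> linarith [hp.1, hp.2]))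
  rw [smoothedDensity, mul_one_div, div_le_iff₀ hpos]
  linarith

/-- For every `ε` many colluders have a strategy that keeps their score below `(1 + ε) 2 / π`
whatever the bias. -/
theorem eventually_exists_strategy {ε : ℝ} (hε : 0 < ε) :
    ∀ᶠ C : ℕ in atTop, ∃ ρ : PirateStrategy C, ∀ p ∈ Set.Icc (0 : ℝ) 1,
      coalitionScoreAt ρ p ≤ (1 + ε) * (2 / π) := by
  -- As `δ` tends to 0, the arcsine tends to `π / 2` and its reciprocal to `2 / π`.
  obtain ⟨δ, hδ, hA, hAε⟩ : ∃ δ > 0, 0 < arcsin (1 / √(1 + δ)) ∧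
      1 / arcsin (1 / √(1 + δ)) < (1 + ε / 2) * (2 / π) := by
    have hc : ContinuousAt (fun δ => arcsin (1 / √(1 + δ))) 0 :=
      continuous_arcsin.continuousAt.comp (f := fun δ => 1 / √(1 + δ))
        (continuousAt_const.div (by fun_prop) (by simp))
    have hpos : 0 < arcsin (1 / √(1 + (0 : ℝ))) := by simp; positivity
    have h1 : ∀ᶠ δ in 𝓝[>] (0 : ℝ), 0 < arcsin (1 / √(1 + δ)) :=
      nhdsWithin_le_nhds (hc.eventually_const_lt hpos)
    have h2 : ∀ᶠ δ in 𝓝[>] (0 : ℝ), 1 / arcsin (1 / √(1 + δ)) < (1 + ε / 2) * (2 / π) := by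
      have h0 : 1 / arcsin (1 / √(1 + (0 : ℝ))) < (1 + ε / 2) * (2 / π) := by
        simp only [add_zero, sqrt_one, div_one, arcsin_one, one_div_div]
        exact lt_mul_of_one_lt_left (by positivity) (by linarith)
      exact nhdsWithin_le_nhds ((continuousAt_const.div hc hpos.ne').eventually_lt_const h0)
    obtain ⟨δ, h3, h4, h5⟩ := (h1.and (h2.and self_mem_nhdsWithin)).exists
    exact ⟨δ, h5, h3, h4⟩
  set A := arcsin (1 / √(1 + δ)) with hAdef
  -- `G` is the arcsine distribution function, smoothed so that its derivative stays bounded at 0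
  -- and 1, and rescaled to run from 0 to 1.
  set G : ℝ → ℝ := fun p => (arcsin ((2 * p - 1) / √(1 + δ)) + A) / (2 * A) with hGdef
  set φ : ℝ → ℝ := fun p => smoothedDensity δ (2 * p - 1) / A with hφdef
  have hmaps : ∀ p ∈ Set.Icc (0 : ℝ) 1, 2 * p - 1 ∈ Set.Icc (-1 : ℝ) 1 := fun p hp => by
    constructor <;> linarith [hp.1, hp.2]
  have hG0 : G 0 = 0 := by
    simp [hGdef, hAdef, neg_div, arcsin_neg]
  have hG1 : G 1 = 1 := by
    simp only [hGdef]
    rw [show (2 : ℝ) * 1 - 1 = 1 by norm_num, ← hAdef]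
    field_simp
    norm_num
  have hmono : Monotone G := fun a b hab => by
    simp only [hGdef]
    gcongr
  have hGm : ∀ p ∈ Set.Icc (0 : ℝ) 1, G p ∈ Set.Icc (0 : ℝ) 1 := fun p hp =>
    ⟨hG0 ▸ hmono hp.1, hG1 ▸ hmono hp.2⟩
  have hG : ∀ p ∈ Set.Icc (0 : ℝ) 1, HasDerivAt G (φ p) p := fun p hp => by
    have h1 : HasDerivAt (fun p : ℝ => 2 * p - 1) 2 p := by
      simpa using ((hasDerivAt_id p).const_mul 2).sub_const 1
    have h2 := ((HasDerivAt.comp p (hasDerivAt_arcsin_div hδ (hmaps p hp)) h1).add_const A).div_const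
      (2 * A)
    refine h2.congr_deriv ?_
    simp only [hφdef]
    field_simp
  have hφ : ContinuousOn φ (Set.Icc 0 1) :=
    ((continuousOn_smoothedDensity hδ).comp (by fun_prop) hmaps).div_const A
  have hev := eventually_derivative_outputPoly_le hGm hG0 hG1 hG hφ
    (show 0 < ε / π by positivity)
  obtain ⟨n₀, hn₀⟩ := eventually_atTop.1 hev
  filter_upwards [eventually_ge_atTop (n₀ + 1)] with C hC
  obtain ⟨n, rfl⟩ : ∃ n, C = n + 1 := ⟨C - 1, by omega⟩
  refine ⟨proportionStrategy (by omega) G hGm hG0 hG1, fun p hp => ?_⟩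
  rw [coalitionScoreAt_eq _ hp]
  have h1 := mul_le_mul_of_nonneg_left (hn₀ n (by omega) p hp) (Real.sqrt_nonneg (p * (1 - p)))
  have h2 := sqrt_mul_smoothedDensity_le hδ hp
  have h3 : √(p * (1 - p)) ≤ 1 / 2 := by
    rw [Real.sqrt_le_left (by norm_num)]
    nlinarith [sq_nonneg (p - 1 / 2)]
  have h4 : √(p * (1 - p)) * φ p ≤ 1 / 2 / A := by
    simp only [hφdef]
    rw [← mul_div_assoc]
    gcongr
  have h5 : √(p * (1 - p)) * (ε / π) ≤ 1 / 2 * (ε / π) := by gcongr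
  have h6 : 1 / 2 / A = 1 / 2 * (1 / A) := by ring
  -- The score is at most `1 / A + ε / π`; each summand uses up half of the allowance `ε * (2 / π)`.
  have h7 : (1 + ε / 2) * (2 / π) + ε / π = (1 + ε) * (2 / π) := by ring
  linarith

/-! ### Asymptotic optimality -/

theorem guaranteedScore_arcsineDist {C : ℕ} (hC : 1 ≤ C) : guaranteedScore C arcsineDist = 2 / π := by
  have := nonempty_pirateStrategy hC
  have h : ∀ ρ : PirateStrategy C, coalitionScore arcsineDist ρ = 2 / π := fun ρ => by
    rw [(hasMoments_arcsineDist C).coalitionScore_eq isBiasDistribution_arcsineDist ρ, mul_one_div]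
  rw [guaranteedScore, iInf_congr h, ciInf_const]

theorem guaranteedScore_le {C : ℕ} {ν : Measure ℝ} (hν : IsBiasDistribution ν)
    (ρ : PirateStrategy C) {b : ℝ} (hb : 0 ≤ b)
    (h : ∀ p ∈ Set.Icc (0 : ℝ) 1, coalitionScoreAt ρ p ≤ b) : guaranteedScore C ν ≤ b := by
  have := hν.1
  have hle : coalitionScore ν ρ ≤ b := by
    have hint : Integrable (fun p => coalitionScoreAt ρ p) ν := by
      refine ((hν.integrable_sqrt_mul (derivative (outputPoly ρ))).const_mul 2).congr ?_
      filter_upwards [hν.ae_mem] with p hp using (coalitionScoreAt_eq ρ hp).symm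
    have h1 := integral_mono_ae hint (integrable_const b)
      (by filter_upwards [hν.ae_mem] with p hp using h p hp)
    simpa [coalitionScore] using h1
  by_cases hbdd : BddBelow (Set.range fun ρ : PirateStrategy C => coalitionScore ν ρ)
  · exact (ciInf_le hbdd ρ).trans hle
  -- A real infimum that is unbounded below has the default value 0; hence the assumption `0 ≤ b`.
  · exact (Real.iInf_of_not_bddBelow hbdd).trans_le hb

theorem isAsymptoticallyOptimal_arcsineDist : IsAsymptoticallyOptimal arcsineDist := by
  refine ⟨isBiasDistribution_arcsineDist, ?_, fun ε hε => ?_⟩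
  · filter_upwards [eventually_ge_atTop 1] with C hC
    rw [guaranteedScore_arcsineDist hC]
    positivity
  · filter_upwards [eventually_ge_atTop 1, eventually_exists_strategy hε] with C hC h ν hν
    obtain ⟨ρ, hρ⟩ := h
    rw [guaranteedScore_arcsineDist hC]
    exact guaranteedScore_le hν ρ (by positivity) hρ

end

end Tardos

end

theorem mainTheorem2 :
    (∀ c : ℕ, 1 ≤ c →
      (∀ p : ℝ, cdf (gaussLegendreDist c) p = gaussLegendreCDF c p) ∧
      ∀ C : ℕ, (C = 2 * c - 1 ∨ C = 2 * c) →
        ∀ μ : Measure ℝ, IsOptimal C μ ↔ μ = gaussLegendreDist c) ∧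
    (∀ p ∈ Set.Ioo (0 : ℝ) 1,
      Tendsto (fun c : ℕ => gaussLegendreCDF c p) atTop (𝓝 (arcsineCDF p))) ∧
    IsAsymptoticallyOptimal arcsineDist :=
  ⟨fun _ hc => ⟨cdf_gaussLegendreDist hc, fun _ hC μ => isOptimal_iff hc hC μ⟩,
    fun _ hp => tendsto_gaussLegendreCDF hp, isAsymptoticallyOptimal_arcsineDist⟩
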